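/- Let $N\ge 1$ and $L\ge 0$ be integers. For functions $f,g:\mathbb{C}^N\to\mathbb{C}$ (continuous on the unit torus) let $$\langle f,g\rangle_V=\frac{1}{(2\pi)^N N!}\int_{[0,2\pi]^N} f(e^{i\theta})\,\overline{g(e^{i\theta})}\,\prod_{1\le i<j\le N}\bigl|e^{i\theta_j}-e^{i\theta_i}\bigr|^2\,d\theta,\qquad \|f\|_V=\langle f,f\rangle_V^{1/2}.$$ Let $\mathrm{Sym}_L$ be the class of functions $f:\mathbb{C}^N\to\mathbb{C}$ of the form $$f(x)=\rho\bigl(\phi_1(x),\dots,\phi_L(x)\bigr),\qquad \phi_l(x)=\sum_{n=1}^N\psi_l(x_n),$$ where $\rho:\mathbb{C}^L\to\mathbb{C}$ and $\psi_1,\dots,\psi_L:\mathbb{C}\to\mathbb{C}$ are arbitrary feed-forward neural networks with complex weights and entire (analytic on $\mathbb{C}$) activations, of any width and depth. **Theorem.** $$\sup_{g}\ \inf_{f\in\mathrm{Sym}_L}\|f-g\|_V^2\ \ge\ 1-\frac{2L}{N},$$ where $g$ ranges over the symmetric polynomials in $\mathbb{C}[x_1,\dots,x_N]$ with $\|g\|_V=1$.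 Moreover, there is a single such $g$ with $\|f-g\|_V^2\ge 1-\frac{2L}{N}$ for all $f\in\mathrm{Sym}_L$. If $N$ is even, one may take $$g=\frac{1}{\sqrt N}\sum_{t=1}^{N/2}p_t^2,\qquad p_t(x)=\frac{1}{\sqrt t}\sum_{n=1}^N x_n^t ,$$ which is a symmetric polynomial with $\|g\|_V=1$. In particular, if $L\le N/4$, then the above supremum is at least $\frac12$. -/

import Mathlib

/-- `IsAnalyticNetwork F`: the function `F : ℂ^d → ℂ` is computed by a (feed-forward) neural
network with analytic activations.  Inputs are networks, and so is a neuron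
`x ↦ σ (∑ i, w i * h i x + b)` fed by finitely many networks `h i`, with arbitrary complex weights
and bias and an arbitrary entire activation `σ`.  Width, depth and weights are unrestricted, and the
activation may vary from neuron to neuron (`σ = id` gives affine output neurons). -/
inductive IsAnalyticNetwork {d : ℕ} : ((Fin d → ℂ) → ℂ) → Prop
  | input (i : Fin d) : IsAnalyticNetwork (fun x => x i)
  | neuron {k : ℕ} (h : Fin k → (Fin d → ℂ) → ℂ) (w : Fin k → ℂ) (b : ℂ) (σ : ℂ → ℂ)
      (hσ : AnalyticOnNhd ℂ σ Set.univ) (hh : ∀ i, IsAnalyticNetwork (h i)) :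
      IsAnalyticNetwork (fun x => σ (∑ i, w i * h i x + b))

/-- The class `Sym_L` of singleton symmetric networks of symmetric width `L`, on sets of `N`
elements of dimension `D = 1`: functions
`f x = ρ (φ_1 x, …, φ_L x)` with `φ_l x = ∑ n, ψ_l (x n)`. -/
def SymNet (N L : ℕ) : Set ((Fin N → ℂ) → ℂ) :=
  {f | ∃ (ρ : (Fin L → ℂ) → ℂ) (ψ : Fin L → (Fin 1 → ℂ) → ℂ),
    IsAnalyticNetwork ρ ∧ (∀ l, IsAnalyticNetwork (ψ l)) ∧
    ∀ x, f x = ρ (fun l => ∑ n, ψ l (fun _ => x n))}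

/-- The Vandermonde determinant `∏_{i < j} (z_j - z_i)`. -/
def vandermondeDet {N : ℕ} (z : Fin N → ℂ) : ℂ :=
  ∏ i, ∏ j ∈ Finset.Ioi i, (z j - z i)

/-- The point `(e^{i θ_1}, …, e^{i θ_N})` of the torus. -/
noncomputable def torusPoint {N : ℕ} (θ : Fin N → ℝ) : Fin N → ℂ :=
  fun n => Complex.exp (Complex.I * (θ n : ℂ))

/-- The Vandermonde inner product
`⟨f, g⟩_V = 1 / ((2π)^N N!) ∫_{[0,2π]^N} f(e^{iθ}) conj(g(e^{iθ})) |V(e^{iθ})|² dθ`. -/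
noncomputable def vInner {N : ℕ} (f g : (Fin N → ℂ) → ℂ) : ℂ :=
  1 / ((2 * (Real.pi : ℂ)) ^ N * (N.factorial : ℂ)) *
    ∫ θ in Set.univ.pi (fun _ : Fin N => Set.Icc (0 : ℝ) (2 * Real.pi)),
      f (torusPoint θ) * (starRingEnd ℂ) (g (torusPoint θ)) *
        ((‖vandermondeDet (torusPoint θ)‖ ^ 2 : ℝ) : ℂ)

/-- The norm `‖f‖_V = √⟨f, f⟩_V`. -/
noncomputable def vNorm {N : ℕ} (f : (Fin N → ℂ) → ℂ) : ℝ :=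
  Real.sqrt (vInner f f).re

/-- The normalized powersum polynomial `p_k = k^{-1/2} ∑ n, x_n ^ k`, with `p_0 = 1`. -/
noncomputable def normPowersum (N k : ℕ) : MvPolynomial (Fin N) ℂ :=
  if k = 0 then 1
  else MvPolynomial.C (((1 / Real.sqrt k : ℝ)) : ℂ) * MvPolynomial.psum (Fin N) ℂ k

/-- The polynomial `N^{-1/2} ∑_{1 ≤ t ≤ N/2} p_t²`. -/
noncomputable def hardPoly (N : ℕ) : MvPolynomial (Fin N) ℂ :=
  MvPolynomial.C (((1 / Real.sqrt N : ℝ)) : ℂ) *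
    ∑ t ∈ Finset.Icc 1 (N / 2), normPowersum N t * normPowersum N t

/-- The squared distance `‖f - g‖_V²` of a function to a polynomial. -/
noncomputable def vError {N : ℕ} (f : (Fin N → ℂ) → ℂ) (g : MvPolynomial (Fin N) ℂ) : ℝ :=
  vNorm (fun x => f x - MvPolynomial.eval x g) ^ 2

/-- The symmetric polynomials of unit Vandermonde norm. -/
def unitSymPoly (N : ℕ) : Set (MvPolynomial (Fin N) ℂ) :=
  {g | g.IsSymmetric ∧ vNorm (fun x => MvPolynomial.eval x g) = 1}

/-! Let `V` be the Vandermonde determinant. For symmetric entire `H`, the Fourier coefficients of `H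
* V` on the torus alternate under permutations of the exponent vector and vanish as soon as one
exponent is negative. The inner product ⟨f, g⟩_V is the coefficient of f · conj g · V at the
staircase exponent (0, …, N-1). Multiplying by a power sum shifts one exponent down, and pairing
with one shifts it up. Alternation cancels nearly all the resulting terms, so that in total degree
at most N multiplication by ∑ x_n^k is adjoint to the derivation k ∂/∂(∑ x_n^k)
(`IsAltFun.adjoint_single`, `IsAltFun.adjoint_pair`). Hence 1, p_s and p_s p_t are orthogonal in
this range, with ‖p_s p_t‖² = 1 for s ≠ t and ‖p_t²‖² = 2.

By Taylor expansion, multiplication by φ_l is also adjoint to a derivation once ψ_l(0) = 0. It is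
determined by the L sequences s ↦ s a_l(s), with a_l the Taylor coefficients of ψ_l. Hadamard's
lemma ρ(y) = ρ(0) + ∑ y_l ρ_l(y), used once or twice, then shows that the vectors s ↦ ⟨f, p_s⟩ and,
for each fixed t, s ↦ ⟨f, p_s p_t⟩ all lie in one space of dimension at most L
(`SymNet.exists_coeff`).

For the hard polynomial the same vectors are multiples of distinct unit vectors e_t. A space of
dimension at most L is far from most of them: the squared distances of K unit vectors to it sum to
at least K - L (`exists_projection_defect`). Bessel's inequality (`bessel_powersum`) turns this into
a lower bound on the error. With K = ⌈N/2⌉ every product that is needed has degree at most N. For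
odd N the vector e_K is supplied by a linear term p_K. -/

open MeasureTheory

/-! ### Integration of Laurent monomials and entire functions over the torus. -/

/-- The Lebesgue measure on the cube `[0, 2π]^N`. -/
noncomputable def cubeMeasure (N : ℕ) : Measure (Fin N → ℝ) :=
  Measure.pi fun _ => (volume : Measure ℝ).restrict (Set.Icc 0 (2 * Real.pi))

instance (N : ℕ) : IsFiniteMeasure (cubeMeasure N) := by
  unfold cubeMeasure; infer_instance

theorem restrict_cube (N : ℕ) :
    (volume : Measure (Fin N → ℝ)).restrict
      (Set.univ.pi fun _ : Fin N => Set.Icc (0 : ℝ) (2 * Real.pi)) = cubeMeasure N := by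
  rw [cubeMeasure, volume_pi, Measure.restrict_pi_pi]

theorem integrable_cube {N : ℕ} {f : (Fin N → ℝ) → ℂ} (hf : Continuous f) :
    Integrable f (cubeMeasure N) := by
  rw [← restrict_cube]
  exact (hf.continuousOn.integrableOn_compact
    (isCompact_univ_pi fun _ => isCompact_Icc) : IntegrableOn f _ volume)

theorem cubeMeasure_perm {N : ℕ} (σ : Equiv.Perm (Fin N)) (f : (Fin N → ℝ) → ℂ) :
    ∫ θ, f (fun i => θ (σ i)) ∂cubeMeasure N = ∫ θ, f θ ∂cubeMeasure N := by
  have h := (measurePreserving_piCongrLeft (α := fun _ : Fin N => ℝ)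
    (fun _ => (volume : Measure ℝ).restrict (Set.Icc 0 (2 * Real.pi))) σ.symm).integral_comp'
    (g := f)
  rw [cubeMeasure]
  rw [← h]
  congr 1
  ext θ
  congr 1
  ext i
  have h2 := Equiv.piCongrLeft_apply_apply (fun _ : Fin N => ℝ) σ.symm θ (σ i)
  rw [Equiv.symm_apply_apply] at h2
  exact h2.symm

@[fun_prop]
theorem continuous_torusPoint {N : ℕ} : Continuous (torusPoint (N := N)) := by
  unfold torusPoint; fun_prop

theorem torusPoint_ne_zero {N : ℕ} (θ : Fin N → ℝ) (n : Fin N) : torusPoint θ n ≠ 0 :=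
  Complex.exp_ne_zero _

theorem conj_torusPoint {N : ℕ} (θ : Fin N → ℝ) (n : Fin N) :
    (starRingEnd ℂ) (torusPoint θ n) = (torusPoint θ n)⁻¹ := by
  rw [torusPoint, ← Complex.exp_neg, ← Complex.exp_conj]
  simp

/-- The Laurent monomial `∏ x_n ^ (-α_n)` on the torus. -/
noncomputable def torusChar {N : ℕ} (α : Fin N → ℤ) (θ : Fin N → ℝ) : ℂ :=
  ∏ n, torusPoint θ n ^ (-α n)

@[fun_prop]
theorem continuous_torusChar {N : ℕ} (α : Fin N → ℤ) : Continuous (torusChar α) := by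
  unfold torusChar
  refine continuous_finsetProd _ fun n _ => Continuous.zpow₀ ?_ _ fun θ => Or.inl ?_
  · exact (continuous_apply n).comp continuous_torusPoint
  · exact torusPoint_ne_zero θ n

theorem torusChar_perm {N : ℕ} (α : Fin N → ℤ) (σ : Equiv.Perm (Fin N)) (θ : Fin N → ℝ) :
    torusChar (fun i => α (σ i)) (fun i => θ (σ i)) = torusChar α θ := by
  unfold torusChar torusPoint
  exact Equiv.prod_comp σ fun i => Complex.exp (Complex.I * (θ i : ℂ)) ^ (-α i)

theorem torusChar_sub_single {N : ℕ} (α : Fin N → ℤ) (n : Fin N) (j : ℤ) (θ : Fin N → ℝ) :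
    torusChar (α - Pi.single n j) θ = torusPoint θ n ^ j * torusChar α θ := by
  unfold torusChar
  have h : ∀ i, torusPoint θ i ^ (-(α - Pi.single n j : Fin N → ℤ) i) =
      (if i = n then torusPoint θ n ^ j else 1) * torusPoint θ i ^ (-α i) := by
    intro i
    by_cases hi : i = n
    · subst hi
      rw [if_pos rfl, ← zpow_add₀ (torusPoint_ne_zero θ i)]
      congr 1
      simp; ring
    · simp [hi]
  rw [Finset.prod_congr rfl fun i _ => h i, Finset.prod_mul_distrib]
  simp

theorem continuous_vandermondeDet {N : ℕ} : Continuous (vandermondeDet (N := N)) := by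
  unfold vandermondeDet; fun_prop

theorem differentiable_vandermondeDet {N : ℕ} : Differentiable ℂ (vandermondeDet (N := N)) := by
  unfold vandermondeDet
  fun_prop

theorem vandermondeDet_eq_det {N : ℕ} (z : Fin N → ℂ) :
    vandermondeDet z = (Matrix.vandermonde z).det := by
  rw [Matrix.det_vandermonde, vandermondeDet]

theorem vandermondeDet_perm {N : ℕ} (σ : Equiv.Perm (Fin N)) (z : Fin N → ℂ) :
    vandermondeDet (fun i => z (σ i)) = Equiv.Perm.sign σ * vandermondeDet z := by
  rw [vandermondeDet_eq_det, vandermondeDet_eq_det, ← Matrix.det_permute]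
  rfl

/-- Cauchy's theorem on the unit circle: dz = i z dθ absorbs one of the k ≥ 1 factors of z. -/
theorem integral_circle_eq_zero {G : ℂ → ℂ} (hG : Differentiable ℂ G) {k : ℤ} (hk : 0 < k) :
    ∫ θ in Set.Icc (0 : ℝ) (2 * Real.pi),
      G (Complex.exp (Complex.I * θ)) * Complex.exp (Complex.I * θ) ^ k = 0 := by
  obtain ⟨m, rfl⟩ : ∃ m : ℕ, k = m + 1 := ⟨(k - 1).toNat, by omega⟩
  have h : (∮ z in C(0, 1), G z * z ^ m) = 0 := by
    refine Complex.circleIntegral_eq_zero_of_differentiable_on_off_countable zero_le_one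
      Set.countable_empty ?_ ?_
    · exact (hG.continuous.mul (continuous_pow m)).continuousOn
    · intro z _
      exact (hG z).mul (differentiableAt_pow m)
  rw [circleIntegral_def_Icc] at h
  have h2 : ∀ θ : ℝ, deriv (circleMap 0 1) θ • (G (circleMap 0 1 θ) * circleMap 0 1 θ ^ m) =
      Complex.I * (G (Complex.exp (Complex.I * θ)) *
        Complex.exp (Complex.I * θ) ^ ((m : ℤ) + 1)) := by
    intro θ
    have e : circleMap 0 1 θ = Complex.exp (Complex.I * θ) := by
      simp [circleMap, mul_comm]
    rw [deriv_circleMap, e, smul_eq_mul, zpow_add_one₀ (Complex.exp_ne_zero _), zpow_natCast]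
    ring
  simp_rw [h2] at h
  rw [integral_const_mul] at h
  exact (mul_eq_zero.mp h).resolve_left Complex.I_ne_zero

/-- Fubini isolates the coordinate n, in which the integrand is entire times a positive power, so
the inner integral already vanishes. -/
theorem integral_cube_eq_zero {N : ℕ} {G : (Fin N → ℂ) → ℂ} (hG : Differentiable ℂ G)
    {α : Fin N → ℤ} {n : Fin N} (hα : α n < 0) :
    ∫ θ, G (torusPoint θ) * torusChar α θ ∂cubeMeasure N = 0 := by
  obtain _ | N := N
  · exact n.elim0
  have hmp := (measurePreserving_piFinSuccAbove (α := fun _ : Fin (N + 1) => ℝ)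
    (fun _ => (volume : Measure ℝ).restrict (Set.Icc 0 (2 * Real.pi))) n).symm
  have hcont : Continuous fun θ => G (torusPoint θ) * torusChar α θ :=
    (hG.continuous.comp continuous_torusPoint).mul (continuous_torusChar α)
  have hint := integrable_cube hcont
  rw [cubeMeasure] at hint ⊢
  rw [← hmp.integral_comp']
  rw [← hmp.integrable_comp_emb (MeasurableEquiv.measurableEmbedding _)] at hint
  refine (integral_prod_symm _ hint).trans ?_
  refine integral_eq_zero_of_ae (Filter.Eventually.of_forall fun y => ?_)
  have hpt : ∀ x : ℝ, torusPoint (n.insertNth x y : Fin (N + 1) → ℝ) =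
      n.insertNth (Complex.exp (Complex.I * x)) (torusPoint y) := by
    intro x
    ext i
    refine Fin.succAboveCases n ?_ (fun j => ?_) i
    · simp [torusPoint]
    · simp [torusPoint]
  have hch : ∀ x : ℝ, torusChar α (n.insertNth x y : Fin (N + 1) → ℝ) =
      Complex.exp (Complex.I * x) ^ (-α n) * torusChar (fun j => α (n.succAbove j)) y := by
    intro x
    unfold torusChar
    rw [hpt, Fin.prod_univ_succAbove _ n]
    simp
  have hd : Differentiable ℂ fun z : ℂ => (n.insertNth z (torusPoint y) : Fin (N + 1) → ℂ) := by
    rw [differentiable_pi]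
    intro i
    refine Fin.succAboveCases n ?_ (fun j => ?_) i
    · simp
    · simp
  have h0 := integral_circle_eq_zero (hG.comp hd) (k := -α n) (by omega)
  have : ∀ x : ℝ, G (torusPoint ((MeasurableEquiv.piFinSuccAbove (fun _ => ℝ) n).symm (x, y))) *
      torusChar α ((MeasurableEquiv.piFinSuccAbove (fun _ => ℝ) n).symm (x, y)) =
      torusChar (fun j => α (n.succAbove j)) y * ((G ∘ fun z : ℂ =>
        (n.insertNth z (torusPoint y) : Fin (N + 1) → ℂ)) (Complex.exp (Complex.I * x)) *
        Complex.exp (Complex.I * x) ^ (-α n)) := by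
    intro x
    have e : (MeasurableEquiv.piFinSuccAbove (fun _ => ℝ) n).symm (x, y) =
        (n.insertNth x y : Fin (N + 1) → ℝ) := rfl
    rw [e, hch, hpt]
    simp only [Function.comp]
    ring
  rw [show (0 : (Fin N → ℝ) → ℂ) y = 0 from rfl, ← mul_zero (torusChar _ y), ← h0,
    ← integral_const_mul]
  exact integral_congr_ae (Filter.Eventually.of_forall this)

theorem integral_cube_char {N : ℕ} (α : Fin N → ℤ) :
    ∫ θ, torusChar α θ ∂cubeMeasure N = if α = 0 then (2 * (Real.pi : ℂ)) ^ N else 0 := by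
  unfold torusChar torusPoint cubeMeasure
  rw [integral_fintype_prod_eq_prod (fun (i : Fin N) (t : ℝ) =>
    Complex.exp (Complex.I * (t : ℂ)) ^ (-α i))]
  split_ifs with h
  · subst h
    simp [Real.pi_pos.le]
  · obtain ⟨i, hi⟩ := Function.ne_iff.mp h
    refine Finset.prod_eq_zero (Finset.mem_univ i) ?_
    have h1 : ∀ k : ℤ, 0 < k → ∫ θ in Set.Icc (0 : ℝ) (2 * Real.pi),
        Complex.exp (Complex.I * θ) ^ k = 0 := fun k hk => by
      simpa using integral_circle_eq_zero (G := fun _ => 1) (differentiable_const 1) hk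
    have hi' : α i ≠ 0 := hi
    rcases lt_or_gt_of_ne hi' with hlt | hgt
    · exact h1 _ (by omega)
    -- Here the exponent is negative; conjugation on the circle reduces it to the positive case.
    · have h2 := congrArg (starRingEnd ℂ) (h1 _ hgt)
      rw [← integral_conj, map_zero] at h2
      rw [← h2]
      congr 1
      ext θ
      rw [map_zpow₀, ← Complex.exp_conj]
      simp [Complex.exp_neg]

/-! ### Fourier coefficients of symmetric functions times the Vandermonde determinant. -/

/-- The Fourier coefficients of `H` times the Vandermonde determinant. -/
noncomputable def torusCoeff {N : ℕ} (H : (Fin N → ℂ) → ℂ) (α : Fin N → ℤ) : ℂ :=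
  1 / (2 * (Real.pi : ℂ)) ^ N *
    ∫ θ, H (torusPoint θ) * vandermondeDet (torusPoint θ) * torusChar α θ ∂cubeMeasure N

/-- The exponent vector `(0, 1, …, N - 1)`. -/
def stair (N : ℕ) : Fin N → ℤ := fun i => (i : ℤ)

/-- Invariance of a function under permutations of its variables. -/
def IsSymmFun {N : ℕ} (H : (Fin N → ℂ) → ℂ) : Prop :=
  ∀ (σ : Equiv.Perm (Fin N)) (x : Fin N → ℂ), H (fun i => x (σ i)) = H x

theorem torusChar_add {N : ℕ} (α β : Fin N → ℤ) (θ : Fin N → ℝ) :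
    torusChar (α + β) θ = torusChar α θ * torusChar β θ := by
  unfold torusChar
  rw [← Finset.prod_mul_distrib]
  refine Finset.prod_congr rfl fun i _ => ?_
  rw [← zpow_add₀ (torusPoint_ne_zero θ i)]
  congr 1
  simp; ring

theorem conj_torusChar {N : ℕ} (α : Fin N → ℤ) (θ : Fin N → ℝ) :
    (starRingEnd ℂ) (torusChar α θ) = torusChar (-α) θ := by
  unfold torusChar
  rw [map_prod]
  refine Finset.prod_congr rfl fun i _ => ?_
  rw [map_zpow₀, conj_torusPoint, inv_zpow', Pi.neg_apply]

theorem vandermondeDet_torus {N : ℕ} (θ : Fin N → ℝ) :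
    vandermondeDet (torusPoint θ) = ∑ σ : Equiv.Perm (Fin N),
      ((Equiv.Perm.sign σ : ℤ) : ℂ) * torusChar (-fun i => stair N (σ i)) θ := by
  rw [vandermondeDet_eq_det, ← Matrix.det_transpose, Matrix.det_apply']
  refine Finset.sum_congr rfl fun σ _ => ?_
  congr 1
  refine Finset.prod_congr rfl fun i _ => ?_
  simp [Matrix.vandermonde, stair]

theorem conj_vandermondeDet_torus {N : ℕ} (θ : Fin N → ℝ) :
    (starRingEnd ℂ) (vandermondeDet (torusPoint θ)) = ∑ σ : Equiv.Perm (Fin N),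
      ((Equiv.Perm.sign σ : ℤ) : ℂ) * torusChar (fun i => stair N (σ i)) θ := by
  rw [vandermondeDet_torus, map_sum]
  refine Finset.sum_congr rfl fun σ _ => ?_
  rw [map_mul, conj_torusChar, neg_neg, map_intCast]

theorem torusCoeff_congr {N : ℕ} {H H' : (Fin N → ℂ) → ℂ}
    (h : ∀ θ, H (torusPoint θ) = H' (torusPoint θ)) (α : Fin N → ℤ) :
    torusCoeff H α = torusCoeff H' α := by
  simp only [torusCoeff, h]

theorem torusCoeff_sum {N : ℕ} {ι : Type*} (s : Finset ι) {H : ι → (Fin N → ℂ) → ℂ}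
    (hH : ∀ i ∈ s, Continuous fun θ => H i (torusPoint θ)) (α : Fin N → ℤ) :
    torusCoeff (fun x => ∑ i ∈ s, H i x) α = ∑ i ∈ s, torusCoeff (H i) α := by
  unfold torusCoeff
  rw [← Finset.mul_sum, ← integral_finsetSum]
  · simp only [Finset.sum_mul]
  · intro i hi
    exact integrable_cube (((hH i hi).mul (continuous_vandermondeDet.comp
      continuous_torusPoint)).mul (continuous_torusChar α))

theorem torusCoeff_add {N : ℕ} {H H' : (Fin N → ℂ) → ℂ}
    (hH : Continuous fun θ => H (torusPoint θ)) (hH' : Continuous fun θ => H' (torusPoint θ))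
    (α : Fin N → ℤ) :
    torusCoeff (fun x => H x + H' x) α = torusCoeff H α + torusCoeff H' α := by
  have := torusCoeff_sum Finset.univ (H := ![H, H']) (fun i _ => by fin_cases i <;> simpa) α
  simpa [Fin.sum_univ_two] using this

theorem torusCoeff_const_mul {N : ℕ} (a : ℂ) (H : (Fin N → ℂ) → ℂ) (α : Fin N → ℤ) :
    torusCoeff (fun x => a * H x) α = a * torusCoeff H α := by
  unfold torusCoeff
  rw [mul_left_comm]
  congr 1
  rw [← integral_const_mul]
  simp only [mul_assoc]

theorem torusCoeff_zpow_mul {N : ℕ} (H : (Fin N → ℂ) → ℂ) (n : Fin N) (j : ℤ) (α : Fin N → ℤ) :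
    torusCoeff (fun x => x n ^ j * H x) α = torusCoeff H (α - Pi.single n j) := by
  unfold torusCoeff
  congr 2
  ext θ
  rw [torusChar_sub_single]
  ring

theorem continuous_torus_zpow {N : ℕ} (n : Fin N) (j : ℤ) :
    Continuous fun θ : Fin N → ℝ => torusPoint θ n ^ j :=
  Continuous.zpow₀ ((continuous_apply n).comp continuous_torusPoint) _
    fun θ => Or.inl (torusPoint_ne_zero θ n)

/-- The exponent j may be negative: conjugating a power sum on the torus inverts its variables, so
this covers both multiplication by power sums and pairing with them. -/
theorem torusCoeff_psum_mul {N : ℕ} {H : (Fin N → ℂ) → ℂ}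
    (hH : Continuous fun θ => H (torusPoint θ)) (j : ℤ) (α : Fin N → ℤ) :
    torusCoeff (fun x => (∑ n, x n ^ j) * H x) α =
      ∑ n, torusCoeff H (α + Pi.single n (-j)) := by
  simp only [Finset.sum_mul]
  rw [torusCoeff_sum]
  · refine Finset.sum_congr rfl fun n _ => ?_
    rw [torusCoeff_zpow_mul, Pi.single_neg, sub_eq_add_neg]
  · exact fun n _ => (continuous_torus_zpow n j).mul hH

theorem torusCoeff_eq_zero_of_neg {N : ℕ} {H : (Fin N → ℂ) → ℂ} (hH : Differentiable ℂ H)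
    {α : Fin N → ℤ} {n : Fin N} (hα : α n < 0) : torusCoeff H α = 0 := by
  unfold torusCoeff
  rw [integral_cube_eq_zero (G := fun x => H x * vandermondeDet x)
    (hH.mul differentiable_vandermondeDet) hα, mul_zero]

theorem torusCoeff_perm {N : ℕ} {H : (Fin N → ℂ) → ℂ} (hH : IsSymmFun H)
    (σ : Equiv.Perm (Fin N)) (α : Fin N → ℤ) :
    torusCoeff H (fun i => α (σ i)) = ((Equiv.Perm.sign σ : ℤ) : ℂ) * torusCoeff H α := by
  unfold torusCoeff
  rw [mul_left_comm]
  congr 1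
  rw [← integral_const_mul, ← cubeMeasure_perm σ]
  congr 1
  ext θ
  have e : torusPoint (fun i => θ (σ i)) = fun i => torusPoint θ (σ i) := rfl
  rw [torusChar_perm, e, hH, vandermondeDet_perm]
  ring

theorem sign_mul_sign_cast {N : ℕ} (σ : Equiv.Perm (Fin N)) :
    ((Equiv.Perm.sign σ : ℤ) : ℂ) * ((Equiv.Perm.sign σ : ℤ) : ℂ) = 1 := by
  rw [← Int.cast_mul, ← Units.val_mul, Int.units_mul_self]
  simp

theorem torusCoeff_swap {N : ℕ} {H : (Fin N → ℂ) → ℂ} (hH : IsSymmFun H) {i j : Fin N}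
    (hij : i ≠ j) (α : Fin N → ℤ) :
    torusCoeff H (fun k => α (Equiv.swap i j k)) = -torusCoeff H α := by
  rw [torusCoeff_perm hH, Equiv.Perm.sign_swap hij]
  simp

/-- Write |V|² = V · conj V and expand conj V over permutations. Since the coefficients alternate,
all N! terms agree with the one at the staircase, and the factor 1/N! cancels. -/
theorem vInner_eq_torusCoeff {N : ℕ} {f g : (Fin N → ℂ) → ℂ} (hf : IsSymmFun f)
    (hg : IsSymmFun g) (hfc : Continuous f) (hgc : Continuous g) :
    vInner f g = torusCoeff (fun x => f x * (starRingEnd ℂ) (g x)) (stair N) := by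
  have hsym : IsSymmFun fun x => f x * (starRingEnd ℂ) (g x) := fun σ x => by
    simp only [hf σ x, hg σ x]
  have key : ∫ θ, f (torusPoint θ) * (starRingEnd ℂ) (g (torusPoint θ)) *
        ((‖vandermondeDet (torusPoint θ)‖ ^ 2 : ℝ) : ℂ) ∂cubeMeasure N =
      ∑ σ : Equiv.Perm (Fin N), ((Equiv.Perm.sign σ : ℤ) : ℂ) *
        ∫ θ, f (torusPoint θ) * (starRingEnd ℂ) (g (torusPoint θ)) *
          vandermondeDet (torusPoint θ) * torusChar (fun i => stair N (σ i)) θ ∂cubeMeasure N := by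
    simp_rw [← integral_const_mul]
    rw [← integral_finsetSum]
    · congr 1
      ext θ
      rw [Complex.ofReal_pow, ← Complex.mul_conj', conj_vandermondeDet_torus, Finset.mul_sum,
        Finset.mul_sum]
      exact Finset.sum_congr rfl fun σ _ => by ring
    · intro σ _
      refine integrable_cube ?_
      have h1 := hfc.comp (continuous_torusPoint (N := N))
      have h2 := Complex.continuous_conj.comp (hgc.comp (continuous_torusPoint (N := N)))
      have h3 := (continuous_vandermondeDet.comp (continuous_torusPoint (N := N)))
      exact continuous_const.mul (((h1.mul h2).mul h3).mul (continuous_torusChar _))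
  have hpi : (2 * (Real.pi : ℂ)) ^ N ≠ 0 :=
    pow_ne_zero _ (mul_ne_zero two_ne_zero (by exact_mod_cast Real.pi_ne_zero))
  have hfac : (N.factorial : ℂ) ≠ 0 := by exact_mod_cast N.factorial_ne_zero
  have hσ : ∀ σ : Equiv.Perm (Fin N), ∫ θ, f (torusPoint θ) * (starRingEnd ℂ) (g (torusPoint θ)) *
          vandermondeDet (torusPoint θ) * torusChar (fun i => stair N (σ i)) θ ∂cubeMeasure N =
      (2 * (Real.pi : ℂ)) ^ N * (((Equiv.Perm.sign σ : ℤ) : ℂ) *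
        torusCoeff (fun x => f x * (starRingEnd ℂ) (g x)) (stair N)) := by
    intro σ
    rw [← torusCoeff_perm hsym, torusCoeff, ← mul_assoc, mul_one_div_cancel hpi, one_mul]
  rw [vInner, restrict_cube, key]
  have h3 : ∀ σ : Equiv.Perm (Fin N), ((Equiv.Perm.sign σ : ℤ) : ℂ) *
      ((2 * (Real.pi : ℂ)) ^ N * (((Equiv.Perm.sign σ : ℤ) : ℂ) *
        torusCoeff (fun x => f x * (starRingEnd ℂ) (g x)) (stair N))) =
      (2 * (Real.pi : ℂ)) ^ N * torusCoeff (fun x => f x * (starRingEnd ℂ) (g x)) (stair N) := by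
    intro σ
    linear_combination (2 * (Real.pi : ℂ)) ^ N *
      torusCoeff (fun x => f x * (starRingEnd ℂ) (g x)) (stair N) * sign_mul_sign_cast σ
  simp only [hσ, h3]
  rw [Finset.sum_const, Finset.card_univ, Fintype.card_perm, Fintype.card_fin, nsmul_eq_mul]
  field_simp

theorem torusCoeff_one {N : ℕ} (α : Fin N → ℤ) :
    torusCoeff (fun _ => 1) α = ∑ σ : Equiv.Perm (Fin N),
      ((Equiv.Perm.sign σ : ℤ) : ℂ) * if α = (fun i => stair N (σ i)) then 1 else 0 := by
  have hpi : (2 * (Real.pi : ℂ)) ^ N ≠ 0 :=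
    pow_ne_zero _ (mul_ne_zero two_ne_zero (by exact_mod_cast Real.pi_ne_zero))
  have h : ∀ θ : Fin N → ℝ, (1 : ℂ) * vandermondeDet (torusPoint θ) * torusChar α θ =
      ∑ σ : Equiv.Perm (Fin N), ((Equiv.Perm.sign σ : ℤ) : ℂ) *
        torusChar (-(fun i => stair N (σ i)) + α) θ := by
    intro θ
    rw [one_mul, vandermondeDet_torus, Finset.sum_mul]
    exact Finset.sum_congr rfl fun σ _ => by rw [torusChar_add, mul_assoc]
  unfold torusCoeff
  simp_rw [h]
  rw [integral_finsetSum, Finset.mul_sum]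
  · refine Finset.sum_congr rfl fun σ _ => ?_
    rw [integral_const_mul, integral_cube_char]
    by_cases hα : α = fun i => stair N (σ i)
    · rw [if_pos hα, if_pos (by rw [hα]; simp)]
      field_simp
    · rw [if_neg hα, if_neg (fun h => hα (by rw [neg_add_eq_zero] at h; exact h.symm))]
      simp
  · exact fun σ _ => integrable_cube (continuous_const.mul (continuous_torusChar _))

theorem torusCoeff_one_stair (N : ℕ) : torusCoeff (fun _ => 1) (stair N) = 1 := by
  rw [torusCoeff_one, Finset.sum_eq_single 1]
  · simp
  · intro σ _ hσ
    rw [if_neg, mul_zero]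
    intro h
    refine hσ (Equiv.ext fun i => ?_)
    have := congrFun h i
    simp only [stair, Nat.cast_inj] at this
    exact (Fin.ext this).symm
  · simp

theorem torusCoeff_one_eq_zero {N : ℕ} {α : Fin N → ℤ} (hα : ∑ i, α i ≠ ∑ i, stair N i) :
    torusCoeff (fun _ => 1) α = 0 := by
  rw [torusCoeff_one]
  refine Finset.sum_eq_zero fun σ _ => ?_
  rw [if_neg, mul_zero]
  rintro rfl
  exact hα (Equiv.sum_comp σ (stair N))

/-! ### Alternating functions near the staircase exponent. -/

/-- Antisymmetry of a function of integer exponent vectors under transpositions. -/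
def IsAltFun {N : ℕ} (c : (Fin N → ℤ) → ℂ) : Prop :=
  ∀ (i j : Fin N), i ≠ j → ∀ α, c (fun k => α (Equiv.swap i j k)) = -c α

theorem IsAltFun.eq_zero {N : ℕ} {c : (Fin N → ℤ) → ℂ} (hc : IsAltFun c) {α : Fin N → ℤ}
    {i j : Fin N} (hij : i ≠ j) (h : α i = α j) : c α = 0 := by
  have h1 := hc i j hij α
  have h2 : (fun k => α (Equiv.swap i j k)) = α := by
    ext k
    rcases eq_or_ne k i with rfl | hki
    · rw [Equiv.swap_apply_left, h]
    · rcases eq_or_ne k j with rfl | hkj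
      · rw [Equiv.swap_apply_right, h]
      · rw [Equiv.swap_apply_of_ne_of_ne hki hkj]
  rw [h2] at h1
  linear_combination h1 / 2

/-- Allows a two-shift sum to be treated as a one-shift sum for another alternating function. -/
theorem IsAltFun.sum_shift {N : ℕ} {c : (Fin N → ℤ) → ℂ} (hc : IsAltFun c) (s : ℤ) :
    IsAltFun fun α => ∑ m, c (α + Pi.single m s) := by
  intro i j hij α
  simp only
  rw [← Finset.sum_neg_distrib, ← Equiv.sum_comp (Equiv.swap i j)]
  refine Finset.sum_congr rfl fun m _ => ?_
  rw [← hc i j hij]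
  congr 1
  ext k
  simp only [Pi.add_apply, Pi.single_apply]
  congr 2
  simp [Equiv.swap_apply_eq_iff]

/-- Moving one entry of the staircase down to an occupied or negative position kills `c`. -/
theorem IsAltFun.stair_single {N : ℕ} {c : (Fin N → ℤ) → ℂ} (hc : IsAltFun c)
    (hneg : ∀ α n, α n < 0 → c α = 0) {n : Fin N} {e : ℤ} (he : e ≠ 0) (hn : (n : ℤ) + e < N) :
    c (stair N + Pi.single n e) = 0 := by
  rcases lt_or_ge ((n : ℤ) + e) 0 with h | h
  · exact hneg _ n (by simpa [stair] using h)
  · obtain ⟨p, hp⟩ : ∃ p : ℕ, (p : ℤ) = n + e := ⟨((n : ℤ) + e).toNat, by omega⟩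
    have hpN : p < N := by omega
    have hne : n ≠ ⟨p, hpN⟩ := by
      rintro h
      have : (n : ℕ) = p := by rw [h]
      omega
    refine hc.eq_zero hne ?_
    simp [stair, hne.symm, hp]

/-- Entry j lands on the value of entry j + a, and this collision kills c unless n is that very
entry and moves away. Swapping j and n then leaves a single displaced entry, at the cost of a sign.
-/
theorem IsAltFun.stair_pair {N : ℕ} {c : (Fin N → ℤ) → ℂ} (hc : IsAltFun c)
    {j n : Fin N} (hjn : n ≠ j) {a : ℤ} (ha : a ≠ 0) (h0 : 0 ≤ (j : ℤ) + a)
    (hN : (j : ℤ) + a < N) (t : ℤ) :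
    c (stair N + Pi.single j a + Pi.single n t) =
      if (n : ℤ) = j + a then -c (stair N + Pi.single j (a + t)) else 0 := by
  obtain ⟨p, hp⟩ : ∃ p : ℕ, (p : ℤ) = j + a := ⟨((j : ℤ) + a).toNat, by omega⟩
  have hpN : p < N := by omega
  split_ifs with h
  · rw [← hc j n hjn.symm]
    congr 1
    ext k
    rcases eq_or_ne k j with rfl | hkj
    · simp [stair, hjn.symm, h]
    · rcases eq_or_ne k n with rfl | hkn
      · simp [stair, hjn, h]; ring
      · rw [Equiv.swap_apply_of_ne_of_ne hkj hkn]
        simp [hkj, hkn]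
  · have hne : j ≠ ⟨p, hpN⟩ := by
      rintro h'
      have : (j : ℕ) = p := by rw [h']
      omega
    have hne2 : n ≠ ⟨p, hpN⟩ := by
      rintro h'
      have : (n : ℕ) = p := by rw [h']
      omega
    refine hc.eq_zero hne ?_
    simp [stair, hne.symm, hne2.symm, hp, hjn.symm]

/-- The sum over `n ≠ j` of shifts of the staircase with one entry moved down by `-a`. -/
theorem IsAltFun.sum_stair_pair {N : ℕ} {c : (Fin N → ℤ) → ℂ} (hc : IsAltFun c)
    {j : Fin N} {a : ℤ} (ha : a ≠ 0) (h0 : 0 ≤ (j : ℤ) + a) (hN : (j : ℤ) + a < N) (t : ℤ) :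
    ∑ n ∈ Finset.univ.erase j, c (stair N + Pi.single j a + Pi.single n t) =
      -c (stair N + Pi.single j (a + t)) := by
  obtain ⟨p, hp⟩ : ∃ p : ℕ, (p : ℤ) = j + a := ⟨((j : ℤ) + a).toNat, by omega⟩
  have hpN : p < N := by omega
  have hne : (⟨p, hpN⟩ : Fin N) ≠ j := by
    rintro h'
    have : (j : ℕ) = p := by rw [← h']
    omega
  rw [Finset.sum_eq_single ⟨p, hpN⟩]
  · rw [hc.stair_pair hne ha h0 hN, if_pos (by simpa using hp)]
  · intro n hn hnp
    rw [hc.stair_pair (Finset.ne_of_mem_erase hn) ha h0 hN, if_neg]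
    intro h
    exact hnp (Fin.ext (by simp; omega))
  · intro h
    exact absurd (Finset.mem_erase.mpr ⟨hne, Finset.mem_univ _⟩) h

theorem card_fin_lt {N k : ℕ} (hk : k ≤ N) :
    (Finset.univ.filter fun j : Fin N => (j : ℕ) < k).card = k := by
  rw [Fin.card_filter_val_lt]; omega

/-- Splitting off the diagonal terms; the terms with `j ≥ k` cancel. -/
theorem IsAltFun.sum_lower {N : ℕ} {b : (Fin N → ℤ) → ℂ} (hb : IsAltFun b) {k : ℕ} (hk : 0 < k)
    (t : ℤ) :
    ∑ j, ∑ n, b (stair N + Pi.single j (-(k : ℤ)) + Pi.single n t) =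
      ∑ j ∈ Finset.univ.filter (fun j : Fin N => (j : ℕ) < k),
        (b (stair N + Pi.single j (t - k)) +
          ∑ n ∈ Finset.univ.erase j, b (stair N + Pi.single j (-(k : ℤ)) + Pi.single n t)) := by
  rw [Finset.sum_filter]
  refine Finset.sum_congr rfl fun j _ => ?_
  have e : stair N + Pi.single j (-(k : ℤ)) + Pi.single j t = stair N + Pi.single j (t - k) := by
    rw [add_assoc, ← Pi.single_add]
    congr 2
    ring
  rw [← Finset.add_sum_erase _ _ (Finset.mem_univ j), e]
  split_ifs with h
  · rfl
  · rw [hb.sum_stair_pair (by omega) (by omega) (by omega)]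
    rw [show -(k : ℤ) + t = t - k by ring]
    ring

/-- Only j < k survives `sum_lower`. There j - k is negative, so the upward shift must hit the same
entry; the net shift t - k then gives a collision or a negative entry unless k = t. The factor t
counts the indices j < k. -/
theorem IsAltFun.adjoint_single {N : ℕ} {c : (Fin N → ℤ) → ℂ} (hc : IsAltFun c)
    (hneg : ∀ α n, α n < 0 → c α = 0) {k t : ℕ} (hk : 0 < k) (htN : t ≤ N) :
    ∑ j, ∑ n, c (stair N + Pi.single j (-(k : ℤ)) + Pi.single n (t : ℤ)) =
      if k = t then (t : ℂ) * c (stair N) else 0 := by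
  rw [hc.sum_lower hk]
  have h1 : ∀ j ∈ Finset.univ.filter (fun j : Fin N => (j : ℕ) < k),
      (c (stair N + Pi.single j ((t : ℤ) - k)) + ∑ n ∈ Finset.univ.erase j,
        c (stair N + Pi.single j (-(k : ℤ)) + Pi.single n (t : ℤ))) =
      if k = t then c (stair N) else 0 := by
    intro j hj
    have hjk : (j : ℕ) < k := (Finset.mem_filter.mp hj).2
    rw [Finset.sum_eq_zero, add_zero]
    · split_ifs with h
      · subst h; simp
      · exact hc.stair_single hneg (by omega) (by omega)
    · intro n hn
      refine hneg _ j ?_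
      have := (Finset.ne_of_mem_erase hn).symm
      simp [stair, this]
      omega
  rw [Finset.sum_congr rfl h1, Finset.sum_const, nsmul_eq_mul]
  split_ifs with h
  · rw [card_fin_lt (by omega), h]
  · simp

/-- This is the Leibniz rule. The entry made negative by -k must be lifted by t, by s or by both.
The contributions at k = s + t, which a derivation does not have, cancel: (s + t) - t - s = 0. -/
theorem IsAltFun.adjoint_pair {N : ℕ} {c : (Fin N → ℤ) → ℂ} (hc : IsAltFun c)
    (hneg : ∀ α n, α n < 0 → c α = 0) {k s t : ℕ} (hk : 0 < k) (hs : 0 < s) (ht : 0 < t)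
    (hst : s + t ≤ N) :
    ∑ j, ∑ n, ∑ m, c (stair N + Pi.single j (-(k : ℤ)) + Pi.single n (t : ℤ) +
        Pi.single m (s : ℤ)) =
      (if k = s then (s : ℂ) * ∑ n, c (stair N + Pi.single n (t : ℤ)) else 0) +
      (if k = t then (t : ℂ) * ∑ n, c (stair N + Pi.single n (s : ℤ)) else 0) := by
  have hb := hc.sum_shift (s : ℤ)
  rw [hb.sum_lower hk]
  -- `Y a b j`: the entry j is lowered by k and raised by a, while a different entry is raised by b.
  set Y : ℤ → ℤ → Fin N → ℂ := fun a b j =>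
    ∑ n ∈ Finset.univ.erase j, c (stair N + Pi.single j (a - k) + Pi.single n b) with hY
  have h1 : ∀ j ∈ Finset.univ.filter (fun j : Fin N => (j : ℕ) < k),
      ((∑ m, c (stair N + Pi.single j ((t : ℤ) - k) + Pi.single m (s : ℤ))) +
        ∑ n ∈ Finset.univ.erase j, ∑ m, c (stair N + Pi.single j (-(k : ℤ)) +
          Pi.single n (t : ℤ) + Pi.single m (s : ℤ))) =
      c (stair N + Pi.single j ((s : ℤ) + t - k)) + Y t s j + Y s t j := by
    intro j hj
    have hjk : (j : ℕ) < k := (Finset.mem_filter.mp hj).2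
    rw [← Finset.add_sum_erase _ _ (Finset.mem_univ j)]
    congr 1
    · congr 1
      rw [add_assoc, ← Pi.single_add]
      congr 3
      ring
    · refine Finset.sum_congr rfl fun n hn => ?_
      have hnj := (Finset.ne_of_mem_erase hn).symm
      rw [Finset.sum_eq_single j]
      · congr 1
        rw [add_right_comm, add_assoc (stair N), ← Pi.single_add]
        congr 3
        ring
      · intro m _ hm
        refine hneg _ j ?_
        simp [stair, hnj, hm.symm]
        omega
      · simp
  rw [Finset.sum_congr rfl h1, Finset.sum_add_distrib, Finset.sum_add_distrib]
  set A := Finset.univ.filter (fun j : Fin N => (j : ℕ) < k) with hA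
  have hX : ∑ j ∈ A, c (stair N + Pi.single j ((s : ℤ) + t - k)) =
      if k = s + t then ((s : ℂ) + t) * c (stair N) else 0 := by
    split_ifs with h
    · have : ∀ j ∈ A, c (stair N + Pi.single j ((s : ℤ) + t - k)) = c (stair N) := by
        intro j _
        rw [h]; simp
      rw [Finset.sum_congr rfl this, Finset.sum_const, hA, card_fin_lt (by omega), h]
      simp
    · refine Finset.sum_eq_zero fun j hj => ?_
      have hjk : (j : ℕ) < k := (Finset.mem_filter.mp hj).2
      exact hc.stair_single hneg (by omega) (by omega)
  have hYgen : ∀ a b : ℕ, 0 < a → 0 < b → a + b ≤ N → ∑ j ∈ A, Y a b j =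
      (if k = a then (a : ℂ) * ∑ n, c (stair N + Pi.single n (b : ℤ)) else 0) -
        if k = a + b then (a : ℂ) * c (stair N) else 0 := by
    intro a b ha hb' hab
    by_cases hka : k = a
    · rw [if_pos hka, if_neg (by omega), sub_zero]
      -- Entry j is back in place. The missing term n = j may be added for free, because j + b < a +
      -- b ≤ N makes it a collision.
      have h2 : ∀ j ∈ A, Y a b j = ∑ n, c (stair N + Pi.single n (b : ℤ)) := by
        intro j hj
        have hjk : (j : ℕ) < k := (Finset.mem_filter.mp hj).2
        rw [← Finset.add_sum_erase _ _ (Finset.mem_univ j),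
          hc.stair_single hneg (n := j) (e := b) (by omega) (by omega), zero_add, hY]
        simp [hka]
      rw [Finset.sum_congr rfl h2, Finset.sum_const, hA, card_fin_lt (by omega), hka]
      simp
    · rw [if_neg hka, zero_sub]
      have h2 : ∀ j ∈ A, Y a b j = if k = a + b ∧ b ≤ (j : ℕ) then -c (stair N) else 0 := by
        intro j hj
        have hjk : (j : ℕ) < k := (Finset.mem_filter.mp hj).2
        rcases lt_or_ge ((j : ℤ) + (a - k)) 0 with hlt | hge
        · rw [if_neg (by omega)]
          refine Finset.sum_eq_zero fun n hn => hneg _ j ?_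
          have hnj := (Finset.ne_of_mem_erase hn).symm
          simp [stair, hnj]
          omega
        · have := hc.sum_stair_pair (j := j) (a := a - k) (by omega) hge (by omega) b
          rw [hY]
          simp only
          rw [this]
          split_ifs with h
          · rw [h.1]; simp
          · rw [hc.stair_single hneg (by omega) (by omega), neg_zero]
      rw [Finset.sum_congr rfl h2]
      split_ifs with h
      · simp only [h, true_and]
        rw [← Finset.sum_filter, Finset.sum_const, nsmul_eq_mul]
        -- The surviving indices are b ≤ j < k = a + b.
        have hcard : (A.filter fun j : Fin N => b ≤ (j : ℕ)).card = a := by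
          have h3 := Finset.card_filter_add_card_filter_not (s := A) (fun j : Fin N => (j : ℕ) < b)
          have h4 : A.filter (fun j : Fin N => (j : ℕ) < b) =
              Finset.univ.filter (fun j : Fin N => (j : ℕ) < b) := by
            ext j
            simp [hA]
            omega
          have h5 : A.card = k := card_fin_lt (by omega)
          rw [h4, card_fin_lt (by omega), h5] at h3
          simp only [not_lt] at h3
          omega
        rw [hcard]
        ring
      · simp [h]
  rw [hX, hYgen t s ht hs (by omega), hYgen s t hs ht hst, add_comm t s]
  split_ifs <;> ring

/-! ### Inner products with power sums as sums of shifted coefficients. -/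

theorem isSymmFun_sum {N : ℕ} (ψ : ℂ → ℂ) : IsSymmFun fun x : Fin N → ℂ => ∑ n, ψ (x n) :=
  fun σ x => Equiv.sum_comp σ fun n => ψ (x n)

theorem IsSymmFun.mul {N : ℕ} {f g : (Fin N → ℂ) → ℂ} (hf : IsSymmFun f) (hg : IsSymmFun g) :
    IsSymmFun fun x => f x * g x := fun σ x => by simp only [hf σ x, hg σ x]

theorem vInner_one {N : ℕ} {f : (Fin N → ℂ) → ℂ} (hf : IsSymmFun f) (hfc : Continuous f) :
    vInner f (fun _ => 1) = torusCoeff f (stair N) := by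
  rw [vInner_eq_torusCoeff hf (fun _ _ => rfl) hfc continuous_const]
  simp

theorem conj_psum_torus {N : ℕ} (t : ℕ) (θ : Fin N → ℝ) :
    (starRingEnd ℂ) (∑ n, torusPoint θ n ^ t) = ∑ n, torusPoint θ n ^ (-(t : ℤ)) := by
  rw [map_sum]
  refine Finset.sum_congr rfl fun n _ => ?_
  rw [map_pow, conj_torusPoint, zpow_neg, zpow_natCast, inv_pow]

theorem vInner_psum {N : ℕ} {f : (Fin N → ℂ) → ℂ} (hf : IsSymmFun f) (hfc : Continuous f)
    (t : ℕ) :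
    vInner f (fun x => ∑ n, x n ^ t) = ∑ n, torusCoeff f (stair N + Pi.single n (t : ℤ)) := by
  rw [vInner_eq_torusCoeff hf (isSymmFun_sum fun z => z ^ t) hfc (by fun_prop),
    torusCoeff_congr (H' := fun x => (∑ n, x n ^ (-(t : ℤ))) * f x), torusCoeff_psum_mul]
  · simp
  · exact hfc.comp continuous_torusPoint
  · intro θ
    rw [conj_psum_torus, mul_comm]

theorem vInner_psum_mul {N : ℕ} {f : (Fin N → ℂ) → ℂ} (hf : IsSymmFun f) (hfc : Continuous f)
    (s t : ℕ) :
    vInner f (fun x => (∑ n, x n ^ s) * ∑ n, x n ^ t) =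
      ∑ n, ∑ m, torusCoeff f (stair N + Pi.single n (t : ℤ) + Pi.single m (s : ℤ)) := by
  have hc := hfc.comp (continuous_torusPoint (N := N))
  rw [vInner_eq_torusCoeff hf
    ((isSymmFun_sum fun z => z ^ s).mul (isSymmFun_sum fun z => z ^ t)) hfc (by fun_prop),
    torusCoeff_congr (H' := fun x => (∑ n, x n ^ (-(t : ℤ))) *
      ((∑ n, x n ^ (-(s : ℤ))) * f x)), torusCoeff_psum_mul]
  · refine Finset.sum_congr rfl fun n _ => ?_
    rw [torusCoeff_psum_mul hc]
    simp
  · exact (continuous_finsetSum _ fun n _ => continuous_torus_zpow n _).mul hc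
  · intro θ
    rw [map_mul, conj_psum_torus, conj_psum_torus]
    ring

/-! ### Multiplication by a symmetric feature as the adjoint of a derivation. -/

theorem exists_taylor_remainder (M : ℕ) {ψ : ℂ → ℂ} (hψ : Differentiable ℂ ψ) :
    ∃ (a : ℕ → ℂ) (r : ℂ → ℂ), Differentiable ℂ r ∧
      ∀ z, ψ z = ∑ k ∈ Finset.range M, a k * z ^ k + z ^ M * r z := by
  induction M with
  | zero => exact ⟨0, ψ, hψ, by simp⟩
  | succ M ih =>
    obtain ⟨a, r, hr, h⟩ := ih
    refine ⟨fun k => if k = M then r 0 else a k, dslope r 0, ?_, fun z => ?_⟩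
    · rw [← differentiableOn_univ, Complex.differentiableOn_dslope Filter.univ_mem]
      exact hr.differentiableOn
    · have h2 : z * dslope r 0 z = r z - r 0 := by
        have := sub_smul_dslope r 0 z
        simpa using this
      have h3 : ∑ k ∈ Finset.range M, (if k = M then r 0 else a k) * z ^ k =
          ∑ k ∈ Finset.range M, a k * z ^ k :=
        Finset.sum_congr rfl fun k hk => by rw [if_neg (Finset.mem_range.mp hk).ne]
      simp only [Finset.sum_range_succ, h3, if_true, pow_succ]
      rw [h]
      linear_combination -(z ^ M) * h2

/-- The Taylor remainder z^M r(z) shifts an exponent below M to a negative one, where coefficients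
of entire functions vanish. No convergence argument is needed. The sequence a depends on ψ and M
only, not on F or β. -/
theorem torusCoeff_sum_entire_mul {N : ℕ} (M : ℕ) {ψ : ℂ → ℂ} (hψ : Differentiable ℂ ψ) :
    ∃ a : ℕ → ℂ, (0 < M → ψ 0 = a 0) ∧
      ∀ F : (Fin N → ℂ) → ℂ, Differentiable ℂ F → ∀ β : Fin N → ℤ, (∀ n, β n < M) →
        torusCoeff (fun x => (∑ n, ψ (x n)) * F x) β =
          ∑ k ∈ Finset.range M, a k * ∑ n, torusCoeff F (β + Pi.single n (-(k : ℤ))) := by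
  obtain ⟨a, r, hr, h⟩ := exists_taylor_remainder M hψ
  refine ⟨a, ?_, fun F hF β hβ => ?_⟩
  · intro hM
    obtain ⟨M, rfl⟩ := Nat.exists_eq_succ_of_ne_zero hM.ne'
    rw [h, Finset.sum_range_succ']
    simp
  have hc := hF.continuous.comp (continuous_torusPoint (N := N))
  have hx : ∀ n : Fin N, Differentiable ℂ fun x : Fin N → ℂ => x n := fun n => by fun_prop
  have e : (fun x : Fin N → ℂ => (∑ n, ψ (x n)) * F x) = fun x =>
      (∑ k ∈ Finset.range M, a k * ((∑ n, x n ^ (k : ℤ)) * F x)) +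
        ∑ n, x n ^ (M : ℤ) * (r (x n) * F x) := by
    ext x
    simp only [h, zpow_natCast]
    rw [Finset.sum_add_distrib, Finset.sum_comm, add_mul, Finset.sum_mul, Finset.sum_mul]
    congr 1
    · exact Finset.sum_congr rfl fun k _ => by rw [← Finset.mul_sum, mul_assoc]
    · exact Finset.sum_congr rfl fun k _ => by rw [mul_assoc]
  have hc1 : ∀ k : ℕ, Continuous fun θ : Fin N → ℝ =>
      a k * ((∑ n, torusPoint θ n ^ (k : ℤ)) * F (torusPoint θ)) := fun k =>
    continuous_const.mul ((continuous_finsetSum _ fun n _ => continuous_torus_zpow n _).mul hc)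
  have hc2 : ∀ n : Fin N, Continuous fun θ : Fin N → ℝ =>
      torusPoint θ n ^ (M : ℤ) * (r (torusPoint θ n) * F (torusPoint θ)) := fun n =>
    (continuous_torus_zpow n _).mul ((hr.continuous.comp
      ((continuous_apply n).comp continuous_torusPoint)).mul hc)
  rw [e, torusCoeff_add
    (H := fun x => ∑ k ∈ Finset.range M, a k * ((∑ n, x n ^ (k : ℤ)) * F x))
    (continuous_finsetSum _ fun k _ => hc1 k)
    (H' := fun x => ∑ n, x n ^ (M : ℤ) * (r (x n) * F x))
    (continuous_finsetSum Finset.univ fun n _ => hc2 n), torusCoeff_sum (Finset.range M)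
      (H := fun k x => a k * ((∑ n, x n ^ (k : ℤ)) * F x)) fun k _ => hc1 k,
    torusCoeff_sum Finset.univ (H := fun n x => x n ^ (M : ℤ) * (r (x n) * F x)) fun n _ => hc2 n]
  rw [Finset.sum_eq_zero (s := Finset.univ), add_zero]
  · refine Finset.sum_congr rfl fun k _ => ?_
    rw [torusCoeff_const_mul, torusCoeff_psum_mul hc]
  · intro n _
    rw [torusCoeff_zpow_mul]
    refine torusCoeff_eq_zero_of_neg (n := n) ((hr.comp (hx n)).mul hF) ?_
    have := hβ n
    simp
    omega

/-- If multiplication by `φ` acts on Fourier coefficients through shifts with weights `a`, then it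
is adjoint to a derivation on power sums of total degree at most `N`. -/
theorem vInner_mul_of_torusCoeff {N : ℕ} {φ : (Fin N → ℂ) → ℂ} (hφ : IsSymmFun φ)
    (hφc : Continuous φ) {a : ℕ → ℂ} (ha0 : a 0 = 0)
    (h : ∀ F : (Fin N → ℂ) → ℂ, Differentiable ℂ F →
      ∀ β : Fin N → ℤ, (∀ n, β n < (2 * N + 1 : ℕ)) →
        torusCoeff (fun x => φ x * F x) β = ∑ k ∈ Finset.range (2 * N + 1),
          a k * ∑ n, torusCoeff F (β + Pi.single n (-(k : ℤ))))
    {F : (Fin N → ℂ) → ℂ} (hF : IsSymmFun F) (hFd : Differentiable ℂ F) :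
    (∀ t, 0 < t → t ≤ N → vInner (fun x => φ x * F x) (fun x => ∑ n, x n ^ t) =
        t * a t * vInner F (fun _ => 1)) ∧
      (∀ s t, 0 < s → 0 < t → s + t ≤ N →
        vInner (fun x => φ x * F x) (fun x => (∑ n, x n ^ s) * ∑ n, x n ^ t) =
          s * a s * vInner F (fun x => ∑ n, x n ^ t) +
            t * a t * vInner F (fun x => ∑ n, x n ^ s)) := by
  have halt : IsAltFun (torusCoeff F) := fun i j hij α => torusCoeff_swap hF hij α
  have hneg : ∀ α n, α n < 0 → torusCoeff F α = 0 := fun α n hn =>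
    torusCoeff_eq_zero_of_neg hFd hn
  have hsym : IsSymmFun fun x : Fin N → ℂ => φ x * F x := hφ.mul hF
  have hcont : Continuous fun x : Fin N → ℂ => φ x * F x := hφc.mul hFd.continuous
  constructor
  · intro t ht htN
    rw [vInner_psum hsym hcont, vInner_one hF hFd.continuous]
    have h1 : ∀ n : Fin N, torusCoeff (fun x => φ x * F x)
        (stair N + Pi.single n (t : ℤ)) = ∑ k ∈ Finset.range (2 * N + 1), a k *
          ∑ j, torusCoeff F (stair N + Pi.single j (-(k : ℤ)) + Pi.single n (t : ℤ)) := by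
      intro n
      rw [h F hFd]
      · simp only [add_right_comm]
      · intro m
        have h2 : (Pi.single n (t : ℤ) : Fin N → ℤ) m ≤ t := by
          rw [Pi.single_apply]; split_ifs <;> omega
        simp only [Pi.add_apply, stair]
        push_cast
        omega
    simp only [h1]
    rw [Finset.sum_comm]
    simp only [← Finset.mul_sum]
    rw [Finset.sum_eq_single t]
    · rw [Finset.sum_comm, halt.adjoint_single hneg ht htN, if_pos rfl]
      ring
    · intro k _ hkt
      rcases Nat.eq_zero_or_pos k with rfl | hk
      · rw [ha0, zero_mul]
      · rw [Finset.sum_comm, halt.adjoint_single hneg hk htN, if_neg hkt, mul_zero]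
    · intro hmem
      exact absurd (Finset.mem_range.mpr (by omega)) hmem
  · intro s t hs ht hst
    rw [vInner_psum_mul hsym hcont, vInner_psum hF hFd.continuous, vInner_psum hF hFd.continuous]
    have h1 : ∀ n m : Fin N, torusCoeff (fun x => φ x * F x)
        (stair N + Pi.single n (t : ℤ) + Pi.single m (s : ℤ)) =
          ∑ k ∈ Finset.range (2 * N + 1), a k * ∑ j, torusCoeff F
            (stair N + Pi.single j (-(k : ℤ)) + Pi.single n (t : ℤ) + Pi.single m (s : ℤ)) := by
      intro n m
      rw [h F hFd]
      · refine Finset.sum_congr rfl fun k _ => ?_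
        congr 1
        refine Finset.sum_congr rfl fun j _ => ?_
        congr 1
        abel
      · intro i
        have h2 : (Pi.single n (t : ℤ) : Fin N → ℤ) i ≤ t := by
          rw [Pi.single_apply]; split_ifs <;> omega
        have h3 : (Pi.single m (s : ℤ) : Fin N → ℤ) i ≤ s := by
          rw [Pi.single_apply]; split_ifs <;> omega
        simp only [Pi.add_apply, stair]
        push_cast
        omega
    set T : ℕ → ℂ := fun k => ∑ j, ∑ n, ∑ m, torusCoeff F
            (stair N + Pi.single j (-(k : ℤ)) + Pi.single n (t : ℤ) + Pi.single m (s : ℤ)) with hT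
    have h4 : ∑ n, ∑ m, torusCoeff (fun x => φ x * F x)
        (stair N + Pi.single n (t : ℤ) + Pi.single m (s : ℤ)) =
          ∑ k ∈ Finset.range (2 * N + 1), a k * T k := by
      simp only [h1, hT, Finset.mul_sum]
      rw [Finset.sum_congr rfl fun n _ => Finset.sum_comm, Finset.sum_comm]
      refine Finset.sum_congr rfl fun k _ => ?_
      rw [Finset.sum_congr rfl fun n _ => Finset.sum_comm, Finset.sum_comm]
    have h5 : ∀ k ∈ Finset.range (2 * N + 1), a k * T k =
        (if k = s then s * a s * ∑ n, torusCoeff F (stair N + Pi.single n (t : ℤ)) else 0) +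
        (if k = t then t * a t * ∑ n, torusCoeff F (stair N + Pi.single n (s : ℤ)) else 0) := by
      intro k _
      rcases Nat.eq_zero_or_pos k with rfl | hk
      · rw [ha0, zero_mul, if_neg (by omega), if_neg (by omega), add_zero]
      · rw [hT]
        simp only
        rw [halt.adjoint_pair hneg hk hs ht hst, mul_add]
        congr 1
        · split_ifs with hks
          · rw [hks]; ring
          · simp
        · split_ifs with hks
          · rw [hks]; ring
          · simp
    rw [h4, Finset.sum_congr rfl h5, Finset.sum_add_distrib, Finset.sum_ite_eq',
      Finset.sum_ite_eq', if_pos (Finset.mem_range.mpr (by omega)),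
      if_pos (Finset.mem_range.mpr (by omega))]

/-- Multiplication by `∑ ψ(x_n)`, `ψ(0) = 0`, is adjoint to a derivation. -/
theorem exists_vInner_sum_mul {N : ℕ} {ψ : ℂ → ℂ} (hψ : Differentiable ℂ ψ) (h0 : ψ 0 = 0) :
    ∃ a : ℕ → ℂ, ∀ F : (Fin N → ℂ) → ℂ, IsSymmFun F → Differentiable ℂ F →
      (∀ t, 0 < t → t ≤ N → vInner (fun x => (∑ n, ψ (x n)) * F x) (fun x => ∑ n, x n ^ t) =
        t * a t * vInner F (fun _ => 1)) ∧
      (∀ s t, 0 < s → 0 < t → s + t ≤ N →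
        vInner (fun x => (∑ n, ψ (x n)) * F x) (fun x => (∑ n, x n ^ s) * ∑ n, x n ^ t) =
          s * a s * vInner F (fun x => ∑ n, x n ^ t) +
            t * a t * vInner F (fun x => ∑ n, x n ^ s)) := by
  -- The staircase entries are at most N - 1 and the upward shifts add at most N in total, so all
  -- exponents stay below 2N + 1.
  obtain ⟨a, ha, h⟩ := torusCoeff_sum_entire_mul (N := N) (2 * N + 1) hψ
  have ha0 : a 0 = 0 := by rw [← ha (by omega), h0]
  exact ⟨a, fun F hF hFd => vInner_mul_of_torusCoeff (isSymmFun_sum ψ)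
    (continuous_finsetSum _ fun n _ => hψ.continuous.comp (continuous_apply n)) ha0 h hF hFd⟩

/-- The case ψ(z) = z^k, from which the orthogonality relations among power sums and their products
follow. -/
theorem vInner_psum_mul_left {N : ℕ} {k : ℕ} (hk : 0 < k) (hkN : k ≤ N)
    {F : (Fin N → ℂ) → ℂ} (hF : IsSymmFun F) (hFd : Differentiable ℂ F) :
    (∀ t, 0 < t → t ≤ N → vInner (fun x => (∑ n, x n ^ k) * F x) (fun x => ∑ n, x n ^ t) =
        t * (if t = k then 1 else 0) * vInner F (fun _ => 1)) ∧
      (∀ s t, 0 < s → 0 < t → s + t ≤ N →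
        vInner (fun x => (∑ n, x n ^ k) * F x) (fun x => (∑ n, x n ^ s) * ∑ n, x n ^ t) =
          s * (if s = k then 1 else 0) * vInner F (fun x => ∑ n, x n ^ t) +
            t * (if t = k then 1 else 0) * vInner F (fun x => ∑ n, x n ^ s)) := by
  refine vInner_mul_of_torusCoeff (a := fun t => if t = k then 1 else 0)
    (isSymmFun_sum fun z => z ^ k) (by fun_prop) (if_neg hk.ne) ?_ hF hFd
  intro F hF β _
  have h := torusCoeff_psum_mul (hF.continuous.comp (continuous_torusPoint (N := N))) (k : ℤ) β
  simp only [zpow_natCast] at h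
  rw [h]
  simp only [ite_mul, one_mul, zero_mul]
  rw [Finset.sum_ite_eq', if_pos (Finset.mem_range.mpr (by omega))]

/-! ### Hadamard's lemma and smoothness of networks. -/

section ParametricIntegral

variable {E : Type} [NormedAddCommGroup E] [NormedSpace ℂ E] [ProperSpace E]

theorem hasFDerivAt_integral_smul {F : Type} [NormedAddCommGroup F] [NormedSpace ℂ F]
    {w : ℝ → ℂ} (hw : Continuous w) {A : E → F} (hA : ContDiff ℂ 1 A) (y₀ : E) :
    HasFDerivAt (fun y => ∫ τ in (0 : ℝ)..1, w τ • A ((τ : ℂ) • y))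
      (∫ τ in (0 : ℝ)..1, (w τ * τ) • fderiv ℂ A ((τ : ℂ) • y₀)) y₀ := by
  have hA' : Continuous (fderiv ℂ A) := hA.continuous_fderiv one_ne_zero
  have hAc := hA.continuous
  have hcont : Continuous fun p : ℝ × E => ‖(w p.1 * p.1) • fderiv ℂ A ((p.1 : ℂ) • p.2)‖ := by
    fun_prop
  obtain ⟨C, hC⟩ := ((isCompact_Icc (a := (0 : ℝ)) (b := 1)).prod
    (isCompact_closedBall y₀ 1)).bddAbove_image hcont.continuousOn
  refine intervalIntegral.hasFDerivAt_integral_of_dominated_of_fderiv_le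
    (F := fun y τ => w τ • A ((τ : ℂ) • y))
    (F' := fun y τ => (w τ * τ) • fderiv ℂ A ((τ : ℂ) • y)) (bound := fun _ => C)
    (Metric.ball_mem_nhds y₀ one_pos) ?_ ?_ ?_ ?_ ?_ ?_
  · refine Filter.Eventually.of_forall fun y => Continuous.aestronglyMeasurable ?_
    fun_prop
  · refine Continuous.intervalIntegrable ?_ _ _
    fun_prop
  · refine Continuous.aestronglyMeasurable ?_
    fun_prop
  · refine Filter.Eventually.of_forall fun τ hτ y hy => ?_
    rw [Set.uIoc_of_le zero_le_one] at hτ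
    exact hC ⟨(τ, y), ⟨⟨hτ.1.le, hτ.2⟩, Metric.ball_subset_closedBall hy⟩, rfl⟩
  · exact intervalIntegrable_const
  · refine Filter.Eventually.of_forall fun τ _ y _ => ?_
    have h1 : HasFDerivAt (fun y : E => (τ : ℂ) • y) ((τ : ℂ) • ContinuousLinearMap.id ℂ E) y :=
      (hasFDerivAt_id y).const_smul (τ : ℂ)
    have h2 := ((hA.differentiable one_ne_zero ((τ : ℂ) • y)).hasFDerivAt.comp y h1).const_smul (w τ)
    refine h2.congr_fderiv ?_
    ext v
    simp [mul_smul]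

/-- Differentiating under the integral replaces A by its derivative and multiplies the weight by τ,
so the induction must range over all targets F and all weights w. -/
theorem contDiff_integral_smul (n : ℕ) : ∀ {F : Type} [NormedAddCommGroup F] [NormedSpace ℂ F]
    {w : ℝ → ℂ}, Continuous w → ∀ {A : E → F}, ContDiff ℂ n A →
    ContDiff ℂ n fun y => ∫ τ in (0 : ℝ)..1, w τ • A ((τ : ℂ) • y) := by
  induction n with
  | zero =>
    intro F _ _ w hw A hA
    have hAc := hA.continuous
    refine contDiff_zero.mpr ?_
    refine intervalIntegral.continuous_parametric_intervalIntegral_of_continuous' ?_ _ _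
    simp only [Function.uncurry_def]
    fun_prop
  | succ n ih =>
    intro F _ _ w hw A hA
    have h1 : ContDiff ℂ 1 A := hA.of_le (by exact_mod_cast Nat.le_add_left 1 n)
    have hd := hasFDerivAt_integral_smul hw h1
    push_cast at hA ⊢
    rw [contDiff_succ_iff_fderiv] at hA ⊢
    refine ⟨fun y => (hd y).differentiableAt, by simp, ?_⟩
    rw [funext fun y => (hd y).fderiv]
    exact ih (by fun_prop) hA.2.2

end ParametricIntegral

/-- Hadamard's lemma in several complex variables. -/
theorem exists_hadamard {L n : ℕ} {ρ : (Fin L → ℂ) → ℂ} (hρ : ContDiff ℂ (n + 1) ρ) :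
    ∃ ρ' : Fin L → (Fin L → ℂ) → ℂ, (∀ l, ContDiff ℂ n (ρ' l)) ∧
      ∀ y, ρ y = ρ 0 + ∑ l, y l * ρ' l y := by
  have hd : Differentiable ℂ ρ := hρ.differentiable (by simp)
  have hA : ContDiff ℂ n (fderiv ℂ ρ) := (contDiff_succ_iff_fderiv.mp hρ).2.2
  have hAl : ∀ l, ContDiff ℂ n fun y => fderiv ℂ ρ y (Pi.single l 1) := fun l =>
    hA.clm_apply contDiff_const
  refine ⟨fun l y => ∫ τ in (0 : ℝ)..1, (1 : ℂ) • fderiv ℂ ρ ((τ : ℂ) • y) (Pi.single l 1),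
    fun l => contDiff_integral_smul n continuous_const (hAl l), fun y => ?_⟩
  have hAc := hA.continuous
  have hderiv : ∀ τ ∈ Set.uIcc (0 : ℝ) 1, HasDerivAt (fun τ : ℝ => ρ ((τ : ℂ) • y))
      -- Integrating this derivative along the segment from 0 to y gives ρ(y) - ρ(0); expanding the
      -- direction y in coordinates produces the factors y_l.
      (fderiv ℂ ρ ((τ : ℂ) • y) y) τ := by
    intro τ _
    have h1 : HasDerivAt (fun τ : ℝ => (τ : ℂ) • y) y τ := by
      simpa using (Complex.ofRealCLM.hasDerivAt (x := τ)).smul_const y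
    have h2 := ((hd ((τ : ℂ) • y)).hasFDerivAt.restrictScalars ℝ).comp_hasDerivAt τ h1
    exact h2
  have h := intervalIntegral.integral_eq_sub_of_hasDerivAt hderiv
    (Continuous.intervalIntegrable (by fun_prop) _ _)
  simp only [Complex.ofReal_one, one_smul, Complex.ofReal_zero, zero_smul] at h
  rw [← sub_eq_iff_eq_add', ← h]
  have h3 : ∀ τ : ℝ, fderiv ℂ ρ ((τ : ℂ) • y) y =
      ∑ l, y l * fderiv ℂ ρ ((τ : ℂ) • y) (Pi.single l 1) := by
    intro τ
    conv_lhs => arg 2; rw [← Finset.univ_sum_single y]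
    rw [map_sum]
    refine Finset.sum_congr rfl fun l _ => ?_
    rw [show (Pi.single l (y l) : Fin L → ℂ) = y l • Pi.single l 1 by simp [← Pi.single_smul],
      map_smul, smul_eq_mul]
  simp only [h3, one_smul]
  rw [intervalIntegral.integral_finsetSum]
  · simp only [intervalIntegral.integral_const_mul]
  · exact fun l _ => Continuous.intervalIntegrable (by fun_prop) _ _

theorem IsAnalyticNetwork.contDiff {d : ℕ} {F : (Fin d → ℂ) → ℂ}
    (hF : IsAnalyticNetwork F) {n : WithTop ℕ∞} : ContDiff ℂ n F := by
  induction hF with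
  | input i => exact contDiff_apply ℂ ℂ i
  | neuron h w b σ hσ hh ih =>
    have hσ' : Differentiable ℂ σ := fun z => (hσ z (Set.mem_univ z)).differentiableAt
    exact hσ'.contDiff.comp
      ((ContDiff.sum fun i _ => contDiff_const.mul (ih i)).add contDiff_const)

/-! ### Distance of the standard basis to a subspace of small dimension. -/

/-- Defects `π t = ‖e_t - P e_t‖²` for the projection `P` onto the span of `L` vectors. -/
theorem exists_projection_defect {L : ℕ} (S : Finset ℕ) (c : Fin L → ℕ → ℂ) :
    ∃ π : ℕ → ℝ, (S.card : ℝ) - L ≤ ∑ t ∈ S, π t ∧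
      ∀ t ∈ S, ∀ (κ : ℂ) (d : Fin L → ℂ),
        ‖κ‖ ^ 2 * π t ≤ ∑ s ∈ S, ‖(∑ l, d l * c l s) - if s = t then κ else 0‖ ^ 2 := by
  let v : Fin L → EuclideanSpace ℂ S := fun l => WithLp.toLp 2 fun s => c l s
  let W : Submodule ℂ (EuclideanSpace ℂ S) := Submodule.span ℂ (Set.range v)
  let e : S → EuclideanSpace ℂ S := fun t => EuclideanSpace.single t 1
  let π' : S → ℝ := fun t => ‖e t - W.starProjection (e t)‖ ^ 2
  have hW : Module.finrank ℂ W ≤ L := by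
    have h := finrank_range_le_card (R := ℂ) v
    rwa [Fintype.card_fin] at h
  have hsq : ∀ t, π' t = 1 - ‖W.orthogonalProjectionOnto (e t)‖ ^ 2 := by
    intro t
    have h1 := Submodule.norm_sq_eq_add_norm_sq_starProjection (e t) W
    rw [Submodule.starProjection_orthogonal_val] at h1
    have h2 : ‖e t‖ = 1 := by simp [e]
    rw [h2] at h1
    simp only [π', Submodule.starProjection_apply, Submodule.coe_norm] at h1 ⊢
    linarith
  -- The trace of an orthogonal projection is its rank.
  have hsum : ∑ t, ‖W.orthogonalProjectionOnto (e t)‖ ^ 2 = Module.finrank ℂ W := by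
    let b := stdOrthonormalBasis ℂ W
    have h1 : ∀ t, ‖W.orthogonalProjectionOnto (e t)‖ ^ 2 =
        ∑ j, ‖inner ℂ ((b j : W) : EuclideanSpace ℂ S) (e t)‖ ^ 2 := by
      intro t
      rw [← b.sum_sq_norm_inner_right]
      refine Finset.sum_congr rfl fun j _ => ?_
      rw [Submodule.inner_orthogonalProjectionOnto_eq_of_mem_left]
    simp only [h1]
    rw [Finset.sum_comm]
    have h2 : ∀ j, ∑ t, ‖inner ℂ ((b j : W) : EuclideanSpace ℂ S) (e t)‖ ^ 2 = 1 := by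
      intro j
      have h3 := (EuclideanSpace.basisFun S ℂ).sum_sq_norm_inner_left ((b j : W) : EuclideanSpace ℂ S)
      simp only [EuclideanSpace.basisFun_apply] at h3
      rw [h3]
      have h4 : ‖((b j : W) : EuclideanSpace ℂ S)‖ = 1 := b.orthonormal.1 j
      rw [h4, one_pow]
    rw [Finset.sum_congr rfl fun j _ => h2 j]
    simp
  refine ⟨fun t => if h : t ∈ S then π' ⟨t, h⟩ else 0, ?_, fun t ht κ d => ?_⟩
  · rw [← Finset.sum_coe_sort]
    have h1 : ∀ t : S, (if h : (t : ℕ) ∈ S then π' ⟨t, h⟩ else 0) = π' t := fun t => by simp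
    rw [Finset.sum_congr rfl fun t _ => (h1 t).trans (hsq t), Finset.sum_sub_distrib, hsum]
    have : (Module.finrank ℂ W : ℝ) ≤ L := by exact_mod_cast hW
    simp
    linarith
  · simp only [dif_pos ht]
    let u : EuclideanSpace ℂ S := ∑ l, d l • v l
    have hu : u ∈ W := Submodule.sum_mem _ fun l _ =>
      W.smul_mem _ (Submodule.subset_span ⟨l, rfl⟩)
    have hmin : ‖κ • e ⟨t, ht⟩ - W.starProjection (κ • e ⟨t, ht⟩)‖ ≤ ‖κ • e ⟨t, ht⟩ - u‖ := by
      rw [Submodule.starProjection_minimal]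
      exact ciInf_le ⟨0, by rintro _ ⟨x, rfl⟩; exact norm_nonneg _⟩ (⟨u, hu⟩ : W)
    rw [map_smul, ← smul_sub, norm_smul] at hmin
    have h2 : ‖κ‖ ^ 2 * π' ⟨t, ht⟩ ≤ ‖κ • e ⟨t, ht⟩ - u‖ ^ 2 := by
      simp only [π']
      rw [← mul_pow]
      exact pow_le_pow_left₀ (by positivity) hmin 2
    refine h2.trans_eq ?_
    rw [EuclideanSpace.norm_sq_eq, ← Finset.sum_coe_sort S]
    refine Finset.sum_congr rfl fun s _ => ?_
    rw [← norm_neg]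
    congr 2
    have h3 : u s = ∑ l, d l * c l s := by
      simp [u, v]
    simp only [PiLp.sub_apply, PiLp.smul_apply, h3, e, PiLp.single_apply, neg_sub,
      Subtype.ext_iff, smul_eq_mul, mul_ite, mul_one, mul_zero]

/-! ### The Hermitian form, orthogonality of power sums and Bessel's inequality. -/

/-- The Vandermonde inner product as a sesquilinear form on continuous functions. -/
noncomputable def vForm (N : ℕ) : C(Fin N → ℂ, ℂ) →ₗ[ℂ] C(Fin N → ℂ, ℂ) →ₗ⋆[ℂ] ℂ :=
  have hint : ∀ f g : C(Fin N → ℂ, ℂ), Integrable (fun θ => f (torusPoint θ) *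
      (starRingEnd ℂ) (g (torusPoint θ)) * ((‖vandermondeDet (torusPoint θ)‖ ^ 2 : ℝ) : ℂ))
      (cubeMeasure N) := fun f g => by
    have := continuous_vandermondeDet (N := N)
    exact integrable_cube (by fun_prop)
  LinearMap.mk₂'ₛₗ (RingHom.id ℂ) (starRingEnd ℂ) (fun f g => vInner f g)
    (fun f f' g => by
      simp only [vInner, restrict_cube, ContinuousMap.add_apply, add_mul]
      rw [integral_add (hint f g) (hint f' g), mul_add])
    (fun a f g => by
      simp only [vInner, restrict_cube, ContinuousMap.smul_apply, smul_eq_mul, mul_assoc,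
        RingHom.id_apply]
      rw [integral_const_mul]; ring)
    (fun f g g' => by
      simp only [vInner, restrict_cube, ContinuousMap.add_apply, map_add, mul_add, add_mul]
      rw [integral_add (hint f g) (hint f g'), mul_add])
    (fun a f g => by
      simp only [vInner, restrict_cube, ContinuousMap.smul_apply, smul_eq_mul, map_mul]
      rw [mul_left_comm]
      congr 1
      rw [← integral_const_mul]
      congr 1
      ext θ
      ring)

theorem vForm_apply {N : ℕ} (f g : C(Fin N → ℂ, ℂ)) : vForm N f g = vInner f g := rfl

theorem vForm_conj {N : ℕ} (f g : C(Fin N → ℂ, ℂ)) :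
    (starRingEnd ℂ) (vForm N f g) = vForm N g f := by
  rw [vForm_apply, vForm_apply, vInner, vInner, map_mul, ← integral_conj]
  congr 1
  · simp [map_ofNat]
  · congr 1
    ext θ
    simp only [map_mul, Complex.conj_conj, Complex.conj_ofReal]
    ring

theorem vForm_self_re_nonneg {N : ℕ} (f : C(Fin N → ℂ, ℂ)) : 0 ≤ (vForm N f f).re := by
  have h : vForm N f f = (((1 / ((2 * Real.pi) ^ N * N.factorial) *
      ∫ θ in Set.univ.pi (fun _ : Fin N => Set.Icc (0 : ℝ) (2 * Real.pi)),
        ‖f (torusPoint θ)‖ ^ 2 * ‖vandermondeDet (torusPoint θ)‖ ^ 2 : ℝ)) : ℂ) := by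
    rw [vForm_apply, vInner, Complex.ofReal_mul, ← integral_complex_ofReal]
    congr 1
    · push_cast; rfl
    · congr 1
      ext θ
      rw [Complex.mul_conj']
      push_cast; rfl
  rw [h, Complex.ofReal_re]
  refine mul_nonneg (by positivity) (integral_nonneg fun θ => by positivity)

theorem vNorm_sq {N : ℕ} (f : C(Fin N → ℂ, ℂ)) : vNorm (f : (Fin N → ℂ) → ℂ) ^ 2 = (vForm N f f).re :=
  Real.sq_sqrt (vForm_self_re_nonneg f)

/-- The power sum of degree `t` as a continuous function. -/
noncomputable def rawPowersum (N t : ℕ) : C(Fin N → ℂ, ℂ) := ⟨fun x => ∑ n, x n ^ t, by fun_prop⟩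

/-- The power sum of degree `t`, divided by `√t`, as a continuous function. -/
noncomputable def powersumMap (N t : ℕ) : C(Fin N → ℂ, ℂ) :=
  ((1 / Real.sqrt t : ℝ) : ℂ) • rawPowersum N t

theorem powersumMap_eq (N t : ℕ) :
    powersumMap N t = ((1 / Real.sqrt t : ℝ) : ℂ) • rawPowersum N t := rfl

theorem vForm_powersum_right {N : ℕ} (f : C(Fin N → ℂ, ℂ)) (t : ℕ) :
    vForm N f (powersumMap N t) = ((1 / Real.sqrt t : ℝ) : ℂ) * vInner f fun x => ∑ n, x n ^ t := by
  rw [powersumMap_eq, LinearMap.map_smulₛₗ, Complex.conj_ofReal, smul_eq_mul]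
  rfl

theorem vForm_powersum_mul_right {N : ℕ} (f : C(Fin N → ℂ, ℂ)) (s t : ℕ) :
    vForm N f (powersumMap N s * powersumMap N t) = ((1 / Real.sqrt s : ℝ) : ℂ) *
      ((1 / Real.sqrt t : ℝ) : ℂ) * vInner f fun x => (∑ n, x n ^ s) * ∑ n, x n ^ t := by
  rw [powersumMap_eq, powersumMap_eq, smul_mul_smul_comm, LinearMap.map_smulₛₗ, map_mul,
    Complex.conj_ofReal, Complex.conj_ofReal, smul_eq_mul]
  rfl

theorem inv_sqrt_sq_mul {t : ℕ} (ht : 0 < t) :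
    ((1 / Real.sqrt t : ℝ) : ℂ) * ((1 / Real.sqrt t : ℝ) : ℂ) * t = 1 := by
  have h : (1 / Real.sqrt t) * (1 / Real.sqrt t) * t = 1 := by
    have h0 : (0 : ℝ) < t := by exact_mod_cast ht
    rw [div_mul_div_comm, Real.mul_self_sqrt h0.le, one_mul, one_div, inv_mul_cancel₀ h0.ne']
  exact_mod_cast h

theorem isSymmFun_powersum (N t : ℕ) : IsSymmFun (powersumMap N t) := fun σ x => by
  simp only [powersumMap_eq, ContinuousMap.smul_apply]
  congr 1
  exact isSymmFun_sum (fun z => z ^ t) σ x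

theorem differentiable_powersum (N t : ℕ) : Differentiable ℂ (powersumMap N t) := by
  have : (powersumMap N t : (Fin N → ℂ) → ℂ) =
      fun x => ((1 / Real.sqrt t : ℝ) : ℂ) * ∑ n, x n ^ t := rfl
  rw [this]
  fun_prop

theorem vForm_one_one (N : ℕ) : vForm N 1 1 = 1 := by
  rw [vForm_apply]
  exact (vInner_one (f := fun _ => 1) (fun _ _ => rfl) continuous_const).trans
    (torusCoeff_one_stair N)

theorem sum_stair_add_single_ne {N : ℕ} {t : ℕ} (ht : 0 < t) (n : Fin N) :
    ∑ i, (stair N + Pi.single n (t : ℤ) : Fin N → ℤ) i ≠ ∑ i, stair N i := by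
  simp [Finset.sum_add_distrib, ht.ne']

theorem vInner_one_psum {N : ℕ} {t : ℕ} (ht : 0 < t) :
    vInner (fun _ : Fin N → ℂ => (1 : ℂ)) (fun x => ∑ n, x n ^ t) = 0 := by
  rw [vInner_psum (fun _ _ => rfl) continuous_const]
  exact Finset.sum_eq_zero fun n _ => torusCoeff_one_eq_zero (sum_stair_add_single_ne ht n)

theorem vInner_one_psum_mul {N : ℕ} {s t : ℕ} (hs : 0 < s) :
    vInner (fun _ : Fin N → ℂ => (1 : ℂ)) (fun x => (∑ n, x n ^ s) * ∑ n, x n ^ t) = 0 := by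
  rw [vInner_psum_mul (fun _ _ => rfl) continuous_const]
  refine Finset.sum_eq_zero fun n _ => Finset.sum_eq_zero fun m _ => torusCoeff_one_eq_zero ?_
  simp only [Pi.add_apply, Finset.sum_add_distrib, Finset.sum_pi_single', Finset.mem_univ, if_true]
  omega

theorem vForm_one_powersum {N : ℕ} {t : ℕ} (ht : 0 < t) : vForm N 1 (powersumMap N t) = 0 := by
  rw [vForm_powersum_right]
  exact mul_eq_zero_of_right _ (vInner_one_psum ht)

theorem vForm_powersum_mul_powersum {N k t : ℕ} (hk : 0 < k) (hkN : k ≤ N) (ht : 0 < t)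
    (htN : t ≤ N) {F : C(Fin N → ℂ, ℂ)} (hF : IsSymmFun F) (hFd : Differentiable ℂ F) :
    vForm N (powersumMap N k * F) (powersumMap N t) = if t = k then vForm N F 1 else 0 := by
  rw [powersumMap_eq N k, smul_mul_assoc, map_smul, LinearMap.smul_apply, vForm_powersum_right]
  have h := (vInner_psum_mul_left hk hkN hF hFd).1 t ht htN
  have e : vInner (rawPowersum N k * F : C(Fin N → ℂ, ℂ)) (fun x => ∑ n, x n ^ t) =
    vInner (fun x => (∑ n, x n ^ k) * F x) (fun x => ∑ n, x n ^ t) := rfl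
  rw [e, h, smul_eq_mul]
  split_ifs with htk
  · subst htk
    have : vForm N F 1 = vInner F (fun _ => 1) := rfl
    rw [this]
    linear_combination vInner F (fun _ => 1) * inv_sqrt_sq_mul ht
  · simp

theorem vForm_powersum_mul_powersum_mul {N k s t : ℕ} (hk : 0 < k) (hkN : k ≤ N) (hs : 0 < s)
    (ht : 0 < t) (hst : s + t ≤ N) {F : C(Fin N → ℂ, ℂ)} (hF : IsSymmFun F)
    (hFd : Differentiable ℂ F) :
    vForm N (powersumMap N k * F) (powersumMap N s * powersumMap N t) =
      (if s = k then vForm N F (powersumMap N t) else 0) +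
        if t = k then vForm N F (powersumMap N s) else 0 := by
  rw [powersumMap_eq N k, smul_mul_assoc, map_smul, LinearMap.smul_apply,
    vForm_powersum_mul_right]
  have h := (vInner_psum_mul_left hk hkN hF hFd).2 s t hs ht hst
  have e : vInner (rawPowersum N k * F : C(Fin N → ℂ, ℂ))
      (fun x => (∑ n, x n ^ s) * ∑ n, x n ^ t) =
    vInner (fun x => (∑ n, x n ^ k) * F x) (fun x => (∑ n, x n ^ s) * ∑ n, x n ^ t) := rfl
  rw [e, h, smul_eq_mul, mul_add, mul_add, vForm_powersum_right, vForm_powersum_right]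
  congr 1
  · split_ifs with hsk
    · subst hsk
      linear_combination ((1 / Real.sqrt t : ℝ) : ℂ) * vInner F (fun x => ∑ n, x n ^ t) *
        inv_sqrt_sq_mul hs
    · simp
  · split_ifs with htk
    · subst htk
      linear_combination ((1 / Real.sqrt s : ℝ) : ℂ) * vInner F (fun x => ∑ n, x n ^ s) *
        inv_sqrt_sq_mul ht
    · simp

theorem vForm_powersum_powersum {N s t : ℕ} (hs : 0 < s) (hsN : s ≤ N) (ht : 0 < t)
    (htN : t ≤ N) : vForm N (powersumMap N s) (powersumMap N t) = if t = s then 1 else 0 := by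
  have h := vForm_powersum_mul_powersum hs hsN ht htN (F := 1) (fun _ _ => rfl)
    (differentiable_const 1)
  rwa [mul_one, vForm_one_one] at h

theorem vForm_powersum_pair {N k s t : ℕ} (hk : 0 < k) (hkN : k ≤ N) (hs : 0 < s)
    (ht : 0 < t) (hst : s + t ≤ N) :
    vForm N (powersumMap N k) (powersumMap N s * powersumMap N t) = 0 := by
  have h := vForm_powersum_mul_powersum_mul hk hkN hs ht hst (F := 1) (fun _ _ => rfl)
    (differentiable_const 1)
  rwa [mul_one, vForm_one_powersum hs, vForm_one_powersum ht, ite_self, ite_self, add_zero] at h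

theorem vForm_pair_powersum {N k s t : ℕ} (hk : 0 < k) (hkN : k ≤ N) (hs : 0 < s)
    (ht : 0 < t) (hst : s + t ≤ N) :
    vForm N (powersumMap N s * powersumMap N t) (powersumMap N k) = 0 := by
  rw [← vForm_conj, vForm_powersum_pair hk hkN hs ht hst, map_zero]

/-- A Wick formula: the derivation adjoint to p_k removes one factor, and p_l pairs with the other.
Both terms contribute when all indices agree, hence ‖p_t²‖² = 2. -/
theorem vForm_pair_pair {N k l s t : ℕ} (hk : 0 < k) (hkN : k ≤ N) (hl : 0 < l) (hlN : l ≤ N)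
    (hs : 0 < s) (ht : 0 < t) (hst : s + t ≤ N) :
    vForm N (powersumMap N k * powersumMap N l) (powersumMap N s * powersumMap N t) =
      (if s = k ∧ t = l then 1 else 0) + if t = k ∧ s = l then 1 else 0 := by
  rw [vForm_powersum_mul_powersum_mul hk hkN hs ht hst (isSymmFun_powersum N l)
    (differentiable_powersum N l), vForm_powersum_powersum hl hlN ht (by omega),
    vForm_powersum_powersum hl hlN hs (by omega), ite_and, ite_and]

/-- Bessel's inequality for the power sums and their products of total degree at most `N`. -/
theorem bessel_powersum {N K : ℕ} (hK : K ≤ N) (r : C(Fin N → ℂ, ℂ)) :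
    1 / 2 * ∑ p ∈ (Finset.Icc 1 K ×ˢ Finset.Icc 1 K).filter (fun p => p.1 + p.2 ≤ N),
        ‖vForm N r (powersumMap N p.1 * powersumMap N p.2)‖ ^ 2 +
      ∑ s ∈ Finset.Icc 1 K, ‖vForm N r (powersumMap N s)‖ ^ 2 ≤ (vForm N r r).re := by
  set P := (Finset.Icc 1 K ×ˢ Finset.Icc 1 K).filter (fun p => p.1 + p.2 ≤ N) with hP
  set y : ℕ × ℕ → ℂ := fun p => vForm N r (powersumMap N p.1 * powersumMap N p.2) with hy
  set z : ℕ → ℂ := fun s => vForm N r (powersumMap N s) with hz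
  have hmem : ∀ p ∈ P, 0 < p.1 ∧ p.1 ≤ N ∧ 0 < p.2 ∧ p.2 ≤ N ∧ p.1 + p.2 ≤ N := by
    intro p hp
    simp only [hP, Finset.mem_filter, Finset.mem_product, Finset.mem_Icc] at hp
    omega
  -- The orthogonal projection of r. The factor 1/2 compensates for ordered pairs: p_s p_t with s ≠
  -- t is listed twice, and p_t² has squared norm 2.
  set h : C(Fin N → ℂ, ℂ) := (1 / 2 : ℂ) • ∑ p ∈ P, y p • (powersumMap N p.1 * powersumMap N p.2) +
    ∑ s ∈ Finset.Icc 1 K, z s • powersumMap N s with hh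
  have h1 : ∀ p ∈ P, vForm N h (powersumMap N p.1 * powersumMap N p.2) = y p := by
    intro p hp
    obtain ⟨a1, a2, a3, a4, a5⟩ := hmem p hp
    have hs : p.swap ∈ P := by
      simp only [hP, Finset.mem_filter, Finset.mem_product, Finset.mem_Icc, Prod.fst_swap,
        Prod.snd_swap] at hp ⊢
      omega
    have hys : y p.swap = y p := by simp only [hy, Prod.fst_swap, Prod.snd_swap, mul_comm]
    simp only [hh, map_add, map_smul, map_sum, LinearMap.add_apply, LinearMap.smul_apply,
      LinearMap.sum_apply, smul_eq_mul]
    have e1 : ∀ q ∈ P, y q * vForm N (powersumMap N q.1 * powersumMap N q.2)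
        (powersumMap N p.1 * powersumMap N p.2) =
        (if p = q then y q else 0) + if p.swap = q then y q else 0 := by
      intro q hq
      obtain ⟨b1, b2, b3, b4, b5⟩ := hmem q hq
      rw [vForm_pair_pair b1 b2 b3 b4 a1 a3 a5, mul_add]
      simp only [Prod.ext_iff, Prod.fst_swap, Prod.snd_swap, mul_ite, mul_one, mul_zero]
    have e2 : ∀ s ∈ Finset.Icc 1 K, z s * vForm N (powersumMap N s)
        (powersumMap N p.1 * powersumMap N p.2) = 0 := by
      intro s hs
      rw [Finset.mem_Icc] at hs
      rw [vForm_powersum_pair (by omega) (by omega) a1 a3 a5, mul_zero]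
    rw [Finset.sum_congr rfl e1, Finset.sum_congr rfl e2, Finset.sum_add_distrib,
      Finset.sum_ite_eq, Finset.sum_ite_eq, if_pos hp, if_pos hs, hys]
    simp; ring
  have h2 : ∀ s ∈ Finset.Icc 1 K, vForm N h (powersumMap N s) = z s := by
    intro s hs
    have hs' := Finset.mem_Icc.mp hs
    simp only [hh, map_add, map_smul, map_sum, LinearMap.add_apply, LinearMap.smul_apply,
      LinearMap.sum_apply, smul_eq_mul]
    rw [Finset.sum_eq_zero, mul_zero, zero_add]
    · rw [Finset.sum_congr rfl fun s' hs' => by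
        rw [vForm_powersum_powersum (by rw [Finset.mem_Icc] at hs'; omega)
          (by rw [Finset.mem_Icc] at hs'; omega) (by omega : 0 < s) (by omega)]]
      simp only [mul_ite, mul_one, mul_zero]
      rw [Finset.sum_ite_eq, if_pos hs]
    · intro q hq
      obtain ⟨b1, b2, b3, b4, b5⟩ := hmem q hq
      rw [vForm_pair_powersum (by omega) (by omega) b1 b3 b5, mul_zero]
  set B : ℝ := 1 / 2 * ∑ p ∈ P, ‖y p‖ ^ 2 + ∑ s ∈ Finset.Icc 1 K, ‖z s‖ ^ 2 with hB
  -- Applied to both h and r, this gives ‖r - h‖² = ‖r‖² - B, whence B ≤ ‖r‖².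
  have key : ∀ f : C(Fin N → ℂ, ℂ), (∀ p ∈ P, vForm N f (powersumMap N p.1 * powersumMap N p.2) = y p) →
      (∀ s ∈ Finset.Icc 1 K, vForm N f (powersumMap N s) = z s) → vForm N f h = B := by
    intro f hf1 hf2
    simp only [hh, map_add, map_sum, LinearMap.map_smulₛₗ, smul_eq_mul]
    have e1 : ∀ p ∈ P, (starRingEnd ℂ) (y p) * vForm N f (powersumMap N p.1 * powersumMap N p.2) =
        ((‖y p‖ ^ 2 : ℝ) : ℂ) := by
      intro p hp
      rw [hf1 p hp, mul_comm, Complex.mul_conj']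
      push_cast; rfl
    have e2 : ∀ s ∈ Finset.Icc 1 K, (starRingEnd ℂ) (z s) * vForm N f (powersumMap N s) =
        ((‖z s‖ ^ 2 : ℝ) : ℂ) := by
      intro s hs
      rw [hf2 s hs, mul_comm, Complex.mul_conj']
      push_cast; rfl
    rw [Finset.sum_congr rfl e1, Finset.sum_congr rfl e2, hB]
    simp [map_ofNat]
  have k1 := key h h1 h2
  have k2 := key r (fun _ _ => rfl) fun _ _ => rfl
  have k3 : vForm N h r = B := by rw [← vForm_conj, k2, Complex.conj_ofReal]
  have k4 := vForm_self_re_nonneg (r - h)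
  simp only [map_sub, LinearMap.sub_apply, k1, k2, k3, Complex.sub_re, Complex.ofReal_re] at k4
  linarith

/-! ### Power-sum coefficients of a network. -/

section Composition

variable {N L : ℕ} {Φ : Fin L → (Fin N → ℂ) → ℂ} {a : Fin L → ℕ → ℂ}

theorem differentiable_comp_features (hΦd : ∀ l, Differentiable ℂ (Φ l)) {ρ : (Fin L → ℂ) → ℂ}
    (hρ : Differentiable ℂ ρ) : Differentiable ℂ fun x => ρ fun l => Φ l x :=
  hρ.comp (differentiable_pi.mpr hΦd)

theorem isSymmFun_comp_features (hΦ : ∀ l, IsSymmFun (Φ l)) (ρ : (Fin L → ℂ) → ℂ) :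
    IsSymmFun fun x => ρ fun l => Φ l x := fun σ x => by
  simp only [hΦ _ σ x]

theorem vInner_comp_features (hΦd : ∀ l, Differentiable ℂ (Φ l)) {ρ : (Fin L → ℂ) → ℂ}
    {ρ' : Fin L → (Fin L → ℂ) → ℂ} (hρ : Differentiable ℂ ρ)
    (hρ' : ∀ l, Differentiable ℂ (ρ' l)) (h : ∀ y, ρ y = ρ 0 + ∑ l, y l * ρ' l y)
    (G : C(Fin N → ℂ, ℂ)) :
    vInner (fun x => ρ fun l => Φ l x) G = ρ 0 * vInner (fun _ => 1) G +
      ∑ l, vInner (fun x => Φ l x * ρ' l fun l => Φ l x) G := by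
  let R : C(Fin N → ℂ, ℂ) := ⟨_, (differentiable_comp_features hΦd hρ).continuous⟩
  let T : Fin L → C(Fin N → ℂ, ℂ) := fun l => ⟨fun x => Φ l x * ρ' l fun l => Φ l x,
    ((hΦd l).mul (differentiable_comp_features hΦd (hρ' l))).continuous⟩
  have hR : R = ρ 0 • 1 + ∑ l, T l := by
    ext x
    simp only [ContinuousMap.add_apply, ContinuousMap.smul_apply, ContinuousMap.sum_apply,
      ContinuousMap.one_apply, smul_eq_mul, mul_one]
    exact h _
  have h2 : vForm N R G = ρ 0 * vForm N 1 G + ∑ l, vForm N (T l) G := by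
    rw [hR]
    simp only [map_add, map_smul, map_sum, LinearMap.add_apply, LinearMap.smul_apply,
      LinearMap.sum_apply, smul_eq_mul]
  exact h2

/-- One Hadamard step removes a feature Φ_l, and its derivation leaves s a_l(s) times ⟨ρ_l(Φ), 1⟩.
The point is that d does not depend on s. -/
theorem exists_vInner_comp_psum (hΦ : ∀ l, IsSymmFun (Φ l)) (hΦd : ∀ l, Differentiable ℂ (Φ l))
    (ha : ∀ l F, IsSymmFun F → Differentiable ℂ F → ∀ t, 0 < t → t ≤ N →
      vInner (fun x => Φ l x * F x) (fun x => ∑ n, x n ^ t) = t * a l t * vInner F (fun _ => 1))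
    {ρ : (Fin L → ℂ) → ℂ} (hρ : ContDiff ℂ 2 ρ) :
    ∃ d : Fin L → ℂ, ∀ s, 0 < s → s ≤ N →
      vInner (fun x => ρ fun l => Φ l x) (fun x => ∑ n, x n ^ s) = ∑ l, d l * (s * a l s) := by
  obtain ⟨ρ', hρ', h⟩ := exists_hadamard (n := 1) (by simpa [one_add_one_eq_two] using hρ)
  have hd : ∀ l, Differentiable ℂ (ρ' l) := fun l => (hρ' l).differentiable (by simp)
  refine ⟨fun l => vInner (fun x => ρ' l fun l => Φ l x) fun _ => 1, fun s hs hsN => ?_⟩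
  have h1 := vInner_comp_features hΦd (hρ.differentiable (by simp)) hd h (rawPowersum N s)
  refine h1.trans ?_
  have h2 : vInner (fun _ : Fin N → ℂ => (1 : ℂ)) (rawPowersum N s) = 0 := vInner_one_psum hs
  rw [h2, mul_zero, zero_add]
  refine Finset.sum_congr rfl fun l _ => ?_
  refine (ha l _ (isSymmFun_comp_features hΦ _) (differentiable_comp_features hΦd (hd l))
    s hs hsN).trans ?_
  ring

/-- After one Hadamard step the derivation hits either p_s, giving s a_l(s) directly, or p_t,
leaving ⟨ρ_l(Φ), p_s⟩, which a second step places in the same span. Each step costs one derivative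
of ρ. -/
theorem exists_vInner_comp_psum_mul (hΦ : ∀ l, IsSymmFun (Φ l))
    (hΦd : ∀ l, Differentiable ℂ (Φ l))
    (ha : ∀ l F, IsSymmFun F → Differentiable ℂ F → ∀ t, 0 < t → t ≤ N →
      vInner (fun x => Φ l x * F x) (fun x => ∑ n, x n ^ t) = t * a l t * vInner F (fun _ => 1))
    (ha2 : ∀ l F, IsSymmFun F → Differentiable ℂ F → ∀ s t, 0 < s → 0 < t → s + t ≤ N →
      vInner (fun x => Φ l x * F x) (fun x => (∑ n, x n ^ s) * ∑ n, x n ^ t) =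
        s * a l s * vInner F (fun x => ∑ n, x n ^ t) +
          t * a l t * vInner F (fun x => ∑ n, x n ^ s))
    {ρ : (Fin L → ℂ) → ℂ} (hρ : ContDiff ℂ 3 ρ) {t : ℕ} (ht : 0 < t) :
    ∃ d : Fin L → ℂ, ∀ s, 0 < s → s + t ≤ N →
      vInner (fun x => ρ fun l => Φ l x) (fun x => (∑ n, x n ^ s) * ∑ n, x n ^ t) =
        ∑ l, d l * (s * a l s) := by
  obtain ⟨ρ', hρ', h⟩ := exists_hadamard (n := 2) (by
    convert hρ using 1
    norm_num)
  have hρ2 : ∀ l, ContDiff ℂ 2 (ρ' l) := fun l => by simpa using hρ' l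
  have hd : ∀ l, Differentiable ℂ (ρ' l) := fun l => (hρ2 l).differentiable (by simp)
  choose e he using fun l => exists_vInner_comp_psum hΦ hΦd ha (hρ2 l)
  refine ⟨fun l => vInner (fun x => ρ' l fun l => Φ l x) (fun x => ∑ n, x n ^ t) +
    ∑ l', t * a l' t * e l' l, fun s hs hst => ?_⟩
  have h1 := vInner_comp_features hΦd (hρ.differentiable (by simp)) hd h
    (rawPowersum N s * rawPowersum N t)
  refine h1.trans ?_
  have h2 : vInner (fun _ : Fin N → ℂ => (1 : ℂ)) (rawPowersum N s * rawPowersum N t :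
      C(Fin N → ℂ, ℂ)) = 0 := vInner_one_psum_mul hs
  rw [h2, mul_zero, zero_add]
  have h3 : ∀ l, vInner (fun x => Φ l x * ρ' l fun l => Φ l x)
      (rawPowersum N s * rawPowersum N t : C(Fin N → ℂ, ℂ)) =
      s * a l s * vInner (fun x => ρ' l fun l => Φ l x) (fun x => ∑ n, x n ^ t) +
        t * a l t * ∑ l', e l l' * (s * a l' s) := fun l => by
    rw [← he l s hs (by omega)]
    exact ha2 l _ (isSymmFun_comp_features hΦ _) (differentiable_comp_features hΦd (hd l))
      s t hs ht hst
  rw [Finset.sum_congr rfl fun l _ => h3 l, Finset.sum_add_distrib]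
  simp only [add_mul, Finset.sum_add_distrib, Finset.mul_sum, Finset.sum_mul]
  congr 1
  · exact Finset.sum_congr rfl fun l _ => by ring
  · rw [Finset.sum_comm]
    exact Finset.sum_congr rfl fun l _ => Finset.sum_congr rfl fun l' _ => by ring

end Composition

/-- The coefficients of a network of symmetric width `L` along power sums, and along products of
power sums with one factor fixed, lie in the span of `L` vectors. -/
theorem SymNet.exists_coeff {N L : ℕ} {f : (Fin N → ℂ) → ℂ} (hf : f ∈ SymNet N L) :
    ∃ (g : C(Fin N → ℂ, ℂ)) (c : Fin L → ℕ → ℂ), (g : (Fin N → ℂ) → ℂ) = f ∧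
      (∃ d : Fin L → ℂ, ∀ s, 0 < s → s ≤ N →
        vForm N g (powersumMap N s) = ∑ l, d l * c l s) ∧
      ∀ t, 0 < t → ∃ d : Fin L → ℂ, ∀ s, 0 < s → s + t ≤ N →
        vForm N g (powersumMap N s * powersumMap N t) = ∑ l, d l * c l s := by
  obtain ⟨ρ, ψ, hρ, hψ, hfx⟩ := hf
  -- A constant term of ψ_l would act as a scalar and not as a derivation. Removing it from all N
  -- summands is undone by translating the argument of ρ by N ψ_l(0).
  let ψ' : Fin L → ℂ → ℂ := fun l z => ψ l (fun _ => z) - ψ l 0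
  let b : Fin L → ℂ := fun l => N * ψ l 0
  let Φ : Fin L → (Fin N → ℂ) → ℂ := fun l x => ∑ n, ψ' l (x n)
  let ρ' : (Fin L → ℂ) → ℂ := fun y => ρ (y + b)
  have hψd : ∀ l, Differentiable ℂ (ψ' l) := fun l => by
    have h1 : Differentiable ℂ (ψ l) := (hψ l).contDiff.differentiable (n := 1) one_ne_zero
    have h2 : Differentiable ℂ fun z : ℂ => fun _ : Fin 1 => z :=
      differentiable_pi.mpr fun _ => differentiable_id
    exact (h1.comp h2).sub_const _
  have hψ0 : ∀ l, ψ' l 0 = 0 := fun l => sub_self _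
  have hΦ : ∀ l, IsSymmFun (Φ l) := fun l => isSymmFun_sum (ψ' l)
  have hΦd : ∀ l, Differentiable ℂ (Φ l) := fun l =>
    Differentiable.fun_sum fun n _ => (hψd l).comp (differentiable_apply n)
  have hρ' : ∀ n : WithTop ℕ∞, ContDiff ℂ n ρ' := fun n =>
    hρ.contDiff.comp (contDiff_id.add contDiff_const)
  have hf' : f = fun x => ρ' fun l => Φ l x := by
    ext x
    rw [hfx]
    simp only [ρ', Φ, ψ', b]
    congr 1
    ext l
    simp
  choose a ha using fun l => exists_vInner_sum_mul (N := N) (hψd l) (hψ0 l)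
  have ha1 : ∀ l F, IsSymmFun F → Differentiable ℂ F → ∀ t, 0 < t → t ≤ N →
      vInner (fun x => Φ l x * F x) (fun x => ∑ n, x n ^ t) =
        t * a l t * vInner F (fun _ => 1) := fun l F hF hFd => (ha l F hF hFd).1
  have ha2 : ∀ l F, IsSymmFun F → Differentiable ℂ F → ∀ s t, 0 < s → 0 < t → s + t ≤ N →
      vInner (fun x => Φ l x * F x) (fun x => (∑ n, x n ^ s) * ∑ n, x n ^ t) =
        s * a l s * vInner F (fun x => ∑ n, x n ^ t) +
          t * a l t * vInner F (fun x => ∑ n, x n ^ s) := fun l F hF hFd => (ha l F hF hFd).2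
  refine ⟨⟨fun x => ρ' fun l => Φ l x, (differentiable_comp_features hΦd
    ((hρ' 1).differentiable one_ne_zero)).continuous⟩,
    fun l s => ((1 / Real.sqrt s : ℝ) : ℂ) * (s * a l s), hf'.symm, ?_, fun t ht => ?_⟩
  · obtain ⟨d, hd⟩ := exists_vInner_comp_psum hΦ hΦd ha1 (hρ' 2)
    refine ⟨d, fun s hs hsN => ?_⟩
    rw [vForm_powersum_right]
    refine (congrArg _ (hd s hs hsN)).trans ?_
    rw [Finset.mul_sum]
    exact Finset.sum_congr rfl fun l _ => by ring
  · obtain ⟨d, hd⟩ := exists_vInner_comp_psum_mul hΦ hΦd ha1 ha2 (hρ' 3) ht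
    refine ⟨fun l => ((1 / Real.sqrt t : ℝ) : ℂ) * d l, fun s hs hst => ?_⟩
    rw [vForm_powersum_mul_right]
    refine (congrArg _ (hd s hs hst)).trans ?_
    rw [Finset.mul_sum]
    exact Finset.sum_congr rfl fun l _ => by ring

/-! ### The hard polynomial and its approximation error. -/

/-- The polynomial `α ∑_{t ≤ N/2} p_t² + β p_K` with `K = ⌈N/2⌉`. -/
noncomputable def quadPoly (N : ℕ) (α β : ℝ) : MvPolynomial (Fin N) ℂ :=
  MvPolynomial.C (α : ℂ) * ∑ t ∈ Finset.Icc 1 (N / 2), normPowersum N t * normPowersum N t +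
    MvPolynomial.C (β : ℂ) * normPowersum N ((N + 1) / 2)

/-- `quadPoly` as a continuous function. -/
noncomputable def quadMap (N : ℕ) (α β : ℝ) : C(Fin N → ℂ, ℂ) :=
  (α : ℂ) • ∑ t ∈ Finset.Icc 1 (N / 2), powersumMap N t * powersumMap N t +
    (β : ℂ) • powersumMap N ((N + 1) / 2)

theorem normPowersum_isSymmetric (N t : ℕ) : (normPowersum N t).IsSymmetric := by
  unfold normPowersum
  split_ifs
  · exact MvPolynomial.IsSymmetric.one
  · exact (MvPolynomial.IsSymmetric.C _).mul (MvPolynomial.psum_isSymmetric _ _ t)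

theorem quadPoly_isSymmetric (N : ℕ) (α β : ℝ) : (quadPoly N α β).IsSymmetric := by
  unfold quadPoly
  refine MvPolynomial.IsSymmetric.add ((MvPolynomial.IsSymmetric.C _).mul ?_)
    ((MvPolynomial.IsSymmetric.C _).mul (normPowersum_isSymmetric _ _))
  exact Subalgebra.sum_mem (MvPolynomial.symmetricSubalgebra (Fin N) ℂ) fun t _ =>
    (normPowersum_isSymmetric N t).mul (normPowersum_isSymmetric N t)

theorem eval_normPowersum {N t : ℕ} (ht : 0 < t) (x : Fin N → ℂ) :
    MvPolynomial.eval x (normPowersum N t) = powersumMap N t x := by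
  rw [normPowersum, if_neg ht.ne']
  simp [powersumMap, rawPowersum, MvPolynomial.psum]

theorem eval_quadPoly {N : ℕ} (hN : 0 < N) (α β : ℝ) (x : Fin N → ℂ) :
    MvPolynomial.eval x (quadPoly N α β) = quadMap N α β x := by
  simp only [quadPoly, quadMap, map_add, map_mul, map_sum, MvPolynomial.eval_C,
    ContinuousMap.add_apply, ContinuousMap.smul_apply, ContinuousMap.sum_apply,
    ContinuousMap.mul_apply, smul_eq_mul]
  rw [eval_normPowersum (by omega)]
  congr 2
  refine Finset.sum_congr rfl fun t ht => ?_
  rw [eval_normPowersum (Finset.mem_Icc.mp ht).1]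

theorem vForm_quadMap_powersum {N : ℕ} (α β : ℝ) {s : ℕ} (hs : 0 < s) (hsN : s ≤ N) :
    vForm N (quadMap N α β) (powersumMap N s) = if s = (N + 1) / 2 then (β : ℂ) else 0 := by
  simp only [quadMap, map_add, map_smul, map_sum, LinearMap.add_apply, LinearMap.smul_apply,
    LinearMap.sum_apply, smul_eq_mul]
  rw [Finset.sum_eq_zero, vForm_powersum_powersum (by omega) (by omega) hs hsN]
  · simp
  · intro t ht
    rw [Finset.mem_Icc] at ht
    exact vForm_pair_powersum hs hsN (by omega) (by omega) (by omega)

theorem vForm_quadMap_pair {N : ℕ} (α β : ℝ) {s t : ℕ} (hs : 0 < s) (ht : 0 < t)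
    (htm : t ≤ N / 2) (hst : s + t ≤ N) :
    vForm N (quadMap N α β) (powersumMap N s * powersumMap N t) =
      if s = t then ((2 * α : ℝ) : ℂ) else 0 := by
  simp only [quadMap, map_add, map_smul, map_sum, LinearMap.add_apply, LinearMap.smul_apply,
    LinearMap.sum_apply, smul_eq_mul]
  rw [vForm_powersum_pair (by omega) (by omega) hs ht hst, mul_zero, add_zero]
  have h : ∀ k ∈ Finset.Icc 1 (N / 2), vForm N (powersumMap N k * powersumMap N k)
      (powersumMap N s * powersumMap N t) = if t = k then (if s = t then 2 else 0) else 0 := by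
    intro k hk
    rw [Finset.mem_Icc] at hk
    rw [vForm_pair_pair (by omega) (by omega) (by omega) (by omega) hs ht hst]
    by_cases htk : t = k
    · by_cases hsk : s = t
      · rw [if_pos ⟨hsk.trans htk, htk⟩, if_pos ⟨htk, hsk.trans htk⟩, if_pos htk, if_pos hsk]
        norm_num
      · rw [if_neg (by omega), if_neg (by omega), if_pos htk, if_neg hsk, add_zero]
    · rw [if_neg (by omega), if_neg (by omega), if_neg htk, add_zero]
  rw [Finset.sum_congr rfl h, Finset.sum_ite_eq, if_pos (Finset.mem_Icc.mpr ⟨ht, htm⟩)]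
  split_ifs
  · push_cast; ring
  · simp

theorem quadPoly_mem_unitSymPoly {N : ℕ} (hN : 0 < N) {α β : ℝ}
    (h : 2 * α ^ 2 * (N / 2 : ℕ) + β ^ 2 = 1) : quadPoly N α β ∈ unitSymPoly N := by
  refine ⟨quadPoly_isSymmetric N α β, ?_⟩
  have e : (fun x => MvPolynomial.eval x (quadPoly N α β)) = quadMap N α β :=
    funext fun x => eval_quadPoly hN α β x
  have h1 : vForm N (quadMap N α β) (quadMap N α β) = 1 := by
    conv_lhs => arg 2; rw [quadMap]
    simp only [map_add, map_sum, LinearMap.map_smulₛₗ, smul_eq_mul, Complex.conj_ofReal]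
    rw [vForm_quadMap_powersum α β (by omega) (by omega), if_pos rfl]
    have h2 : ∀ t ∈ Finset.Icc 1 (N / 2), vForm N (quadMap N α β)
        (powersumMap N t * powersumMap N t) = ((2 * α : ℝ) : ℂ) := by
      intro t ht
      rw [Finset.mem_Icc] at ht
      rw [vForm_quadMap_pair α β (by omega) (by omega) ht.2 (by omega), if_pos rfl]
    rw [Finset.sum_congr rfl h2, Finset.sum_const, Nat.card_Icc, nsmul_eq_mul]
    rw [← Complex.ofReal_one, ← h]
    push_cast
    ring
  rw [e, ← Real.sqrt_one, vNorm]
  congr 1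
  have h2 : vInner (quadMap N α β) (quadMap N α β) = 1 := h1
  rw [h2, Complex.one_re]

/-- For fixed t ≤ N/2 the vector of coefficients along p_s p_t is 2α e_t for the polynomial, and
lies in the L-vector span for f. Bessel's 1/2 turns the resulting (2α)² π_t into 2α² π_t. The linear
coefficients form β e_K and give β² π_K. -/
theorem vError_quadPoly_ge {N L : ℕ} (hN : 0 < N) (α β : ℝ) {f : (Fin N → ℂ) → ℂ}
    (hf : f ∈ SymNet N L) :
    ∃ π : ℕ → ℝ, ((N + 1) / 2 : ℕ) - (L : ℝ) ≤ ∑ t ∈ Finset.Icc 1 ((N + 1) / 2), π t ∧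
      2 * α ^ 2 * ∑ t ∈ Finset.Icc 1 (N / 2), π t + β ^ 2 * π ((N + 1) / 2) ≤
        vError f (quadPoly N α β) := by
  obtain ⟨g, c, rfl, ⟨d₁, hd₁⟩, hd₂⟩ := SymNet.exists_coeff hf
  set K := (N + 1) / 2 with hK
  obtain ⟨π, hπ, hdef⟩ := exists_projection_defect (Finset.Icc 1 K) c
  refine ⟨π, by simpa using hπ, ?_⟩
  have e : vError g (quadPoly N α β) =
      (vForm N (g - quadMap N α β) (g - quadMap N α β)).re := by
    rw [vError, ← vNorm_sq]
    congr 2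
    ext x
    rw [eval_quadPoly hN]
    rfl
  rw [e]
  refine le_trans ?_ (bessel_powersum (K := K) (by omega) _)
  refine add_le_add ?_ ?_
  -- Holds because ⌈N/2⌉ + ⌊N/2⌋ = N.
  · have hsub : Finset.Icc 1 K ×ˢ Finset.Icc 1 (N / 2) ⊆
        (Finset.Icc 1 K ×ˢ Finset.Icc 1 K).filter (fun p => p.1 + p.2 ≤ N) := by
      intro p hp
      simp only [Finset.mem_filter, Finset.mem_product, Finset.mem_Icc] at hp ⊢
      omega
    have h1 := Finset.sum_le_sum_of_subset_of_nonneg hsub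
      (f := fun p => ‖vForm N (g - quadMap N α β) (powersumMap N p.1 * powersumMap N p.2)‖ ^ 2)
      fun _ _ _ => by positivity
    rw [Finset.sum_product_right] at h1
    have h2 : ∀ t ∈ Finset.Icc 1 (N / 2), (2 * α) ^ 2 * π t ≤ ∑ s ∈ Finset.Icc 1 K,
        ‖vForm N (g - quadMap N α β) (powersumMap N s * powersumMap N t)‖ ^ 2 := by
      intro t ht
      rw [Finset.mem_Icc] at ht
      obtain ⟨d, hd⟩ := hd₂ t ht.1
      have h3 := hdef t (Finset.mem_Icc.mpr ⟨ht.1, by omega⟩) ((2 * α : ℝ) : ℂ) d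
      rw [Complex.norm_real, Real.norm_eq_abs, sq_abs] at h3
      refine h3.trans_eq (Finset.sum_congr rfl fun s hs => ?_)
      rw [Finset.mem_Icc] at hs
      rw [map_sub, LinearMap.sub_apply, hd s hs.1 (by omega),
        vForm_quadMap_pair α β hs.1 ht.1 ht.2 (by omega)]
    have h4 := Finset.sum_le_sum h2
    rw [← Finset.mul_sum] at h4
    linarith
  · have h3 := hdef K (Finset.mem_Icc.mpr ⟨by omega, le_rfl⟩) (β : ℂ) d₁
    rw [Complex.norm_real, Real.norm_eq_abs, sq_abs] at h3
    refine h3.trans_eq (Finset.sum_congr rfl fun s hs => ?_)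
    rw [Finset.mem_Icc] at hs
    rw [map_sub, LinearMap.sub_apply, hd₁ s hs.1 (by omega),
      vForm_quadMap_powersum α β hs.1 (by omega)]

theorem hardPoly_eq_quadPoly (N : ℕ) : hardPoly N = quadPoly N (1 / Real.sqrt N) 0 := by
  simp [hardPoly, quadPoly]

theorem hardPoly_bound {N : ℕ} (hN : 0 < N) (hev : Even N) : hardPoly N ∈ unitSymPoly N ∧
    ∀ L, ∀ f ∈ SymNet N L, 1 - 2 * (L : ℝ) / (N : ℝ) ≤ vError f (hardPoly N) := by
  obtain ⟨m, rfl⟩ := hev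
  have hm : (0 : ℝ) < m := by
    have : 0 < m := by omega
    exact_mod_cast this
  have h1 : (m + m) / 2 = m := by omega
  have h2 : (m + m + 1) / 2 = m := by omega
  have hsq : (1 / Real.sqrt ((m + m : ℕ) : ℝ)) ^ 2 = 1 / (m + m) := by
    rw [div_pow, Real.sq_sqrt (by positivity)]
    push_cast; norm_num
  rw [hardPoly_eq_quadPoly]
  refine ⟨quadPoly_mem_unitSymPoly hN ?_, fun L f hf => ?_⟩
  · rw [hsq, h1]
    field_simp
    ring
  · obtain ⟨π, hπ, hle⟩ := vError_quadPoly_ge hN (1 / Real.sqrt ((m + m : ℕ) : ℝ)) 0 hf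
    refine le_trans ?_ hle
    rw [h2] at hπ
    rw [hsq, h1]
    have h3 : 1 - 2 * (L : ℝ) / ((m + m : ℕ) : ℝ) = 2 * (1 / (m + m)) * (m - L) := by
      push_cast
      field_simp
      ring
    rw [h3]
    have h4 := mul_le_mul_of_nonneg_left hπ (by positivity : (0 : ℝ) ≤ 2 * (1 / (m + m)))
    linarith

theorem exists_hard_polynomial {N : ℕ} (hN : 0 < N) : ∃ g ∈ unitSymPoly N,
    ∀ L, ∀ f ∈ SymNet N L, 1 - 2 * (L : ℝ) / (N : ℝ) ≤ vError f g := by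
  rcases Nat.even_or_odd' N with ⟨m, hm | hm⟩
  · exact ⟨hardPoly N, hardPoly_bound hN ⟨m, by omega⟩⟩
  · subst hm
    have h1 : (2 * m + 1) / 2 = m := by omega
    have h2 : (2 * m + 1 + 1) / 2 = m + 1 := by omega
    -- The choice 2α² = β² = 1/(m+1) gives all m + 1 defects equal weight and makes the norm 1.
    have hα : (Real.sqrt (1 / (2 * (m + 1)))) ^ 2 = 1 / (2 * (m + 1)) :=
      Real.sq_sqrt (by positivity)
    have hβ : (Real.sqrt (1 / (m + 1))) ^ 2 = 1 / (m + 1) := Real.sq_sqrt (by positivity)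
    refine ⟨quadPoly (2 * m + 1) (Real.sqrt (1 / (2 * (m + 1)))) (Real.sqrt (1 / (m + 1))),
      quadPoly_mem_unitSymPoly hN ?_, fun L f hf => ?_⟩
    · rw [hα, hβ, h1]
      field_simp
    · obtain ⟨π, hπ, hle⟩ := vError_quadPoly_ge hN (Real.sqrt (1 / (2 * (m + 1))))
        (Real.sqrt (1 / (m + 1))) hf
      refine le_trans ?_ hle
      rw [h2, Finset.sum_Icc_succ_top (by omega)] at hπ
      rw [hα, hβ, h1, h2]
      have h3 : 2 * (1 / (2 * ((m : ℝ) + 1))) * ∑ t ∈ Finset.Icc 1 m, π t +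
          1 / (m + 1) * π (m + 1) = 1 / (m + 1) * (∑ t ∈ Finset.Icc 1 m, π t + π (m + 1)) := by
        field_simp
      rw [h3]
      have h4 := mul_le_mul_of_nonneg_left hπ (by positivity : (0 : ℝ) ≤ 1 / ((m : ℝ) + 1))
      refine le_trans ?_ h4
      have h5 : 1 / ((m : ℝ) + 1) * (((m + 1 : ℕ) : ℝ) - L) = 1 - 2 * L / (2 * m + 2) := by
        push_cast
        field_simp
      rw [h5]
      -- The bound obtained is 1 - 2L/(N+1), slightly stronger than required.
      push_cast
      gcongr
      norm_num

/-! ### The max-min statement. -/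

theorem zero_mem_symNet {N L : ℕ} : (fun _ => 0 : (Fin N → ℂ) → ℂ) ∈ SymNet N L := by
  refine ⟨fun _ => 0, fun _ x => x 0, ?_, fun _ => .input 0, fun _ => rfl⟩
  exact .neuron (k := 0) (fun i => i.elim0) (fun i => i.elim0) 0 (fun _ => 0)
    analyticOnNhd_const fun i => i.elim0

theorem vError_nonneg {N : ℕ} (f : (Fin N → ℂ) → ℂ) (g : MvPolynomial (Fin N) ℂ) :
    0 ≤ vError f g := sq_nonneg _

theorem vError_zero {N : ℕ} {g : MvPolynomial (Fin N) ℂ} (hg : g ∈ unitSymPoly N) :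
    vError (fun _ => 0) g = 1 := by
  have h := hg.2
  unfold vNorm vInner at h
  unfold vError vNorm vInner
  simp only [zero_sub, map_neg, neg_mul_neg]
  rw [h, one_pow]

theorem le_iSup_iInf_vError {N L : ℕ} {c : ℝ} {g : MvPolynomial (Fin N) ℂ}
    (hg : g ∈ unitSymPoly N) (h : ∀ f ∈ SymNet N L, c ≤ vError f g) :
    c ≤ ⨆ g : unitSymPoly N, ⨅ f : SymNet N L, vError (f : (Fin N → ℂ) → ℂ) g := by
  have hbdd : ∀ g : unitSymPoly N,
      BddBelow (Set.range fun f : SymNet N L => vError (f : (Fin N → ℂ) → ℂ) g) := fun g =>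
    ⟨0, by rintro _ ⟨f, rfl⟩; exact vError_nonneg _ _⟩
  have : Nonempty (SymNet N L) := ⟨⟨_, zero_mem_symNet⟩⟩
  -- A real supremum is only meaningful for a family bounded above; the zero network has error 1
  -- against every unit g, so 1 is a bound.
  have habove : BddAbove (Set.range fun g : unitSymPoly N =>
      ⨅ f : SymNet N L, vError (f : (Fin N → ℂ) → ℂ) g) := by
    refine ⟨1, ?_⟩
    rintro _ ⟨g, rfl⟩
    exact (ciInf_le (hbdd g) ⟨_, zero_mem_symNet⟩).trans_eq (vError_zero g.2)
  exact (le_ciInf fun f : SymNet N L => h f f.2).trans (le_ciSup habove ⟨g, hg⟩)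

theorem mainTheorem2 (N L : ℕ) (hN : 0 < N) :
    -- the max-min bound, with the supremum over `g` and the infimum over `f`
    (1 - 2 * (L : ℝ) / (N : ℝ) ≤
      ⨆ g : unitSymPoly N, ⨅ f : SymNet N L, vError (f : (Fin N → ℂ) → ℂ) g) ∧
    -- a single `g` realizes the bound against every `f`
    (∃ g ∈ unitSymPoly N, ∀ f ∈ SymNet N L, 1 - 2 * (L : ℝ) / (N : ℝ) ≤ vError f g) ∧
    -- for even `N` the explicit polynomial is such a `g`
    (Even N → hardPoly N ∈ unitSymPoly N ∧
      ∀ f ∈ SymNet N L, 1 - 2 * (L : ℝ) / (N : ℝ) ≤ vError f (hardPoly N)) ∧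
    -- the constant lower bound up to `L = N / 4`
    (4 * L ≤ N →
      1 / 2 ≤ ⨆ g : unitSymPoly N, ⨅ f : SymNet N L, vError (f : (Fin N → ℂ) → ℂ) g) := by
  obtain ⟨g, hg, h⟩ := exists_hard_polynomial hN
  have hsup := le_iSup_iInf_vError hg (h L)
  refine ⟨hsup, ⟨g, hg, h L⟩, fun hev => ⟨(hardPoly_bound hN hev).1, (hardPoly_bound hN hev).2 L⟩,
    fun hL => le_trans ?_ hsup⟩
  have hL' : 4 * (L : ℝ) ≤ N := by exact_mod_cast hL
  have hN' : (0 : ℝ) < N := by exact_mod_cast hN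
  have : 2 * (L : ℝ) / N ≤ 1 / 2 := by
    rw [div_le_div_iff₀ hN' two_pos]
    linarith
  linarith
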